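/- Symmetric operads $P$ (with sets $P_n$ of $n$-ary operations, left actions of $S_n$ on $P_n$, a unit in $P_1$ and compositions $P_n\times P_{k_1}\times\dots\times P_{k_n}\to P_{k_1+\dots+k_n}$) are regarded as symmetric $\mathbf{Cat}$-operads with discrete categories of operations. Let $P$ be the terminal symmetric operad, whose algebras are commutative monoids, and let $\Phi$ be its standard signature, consisting of one nullary symbol $e$ and one binary symbol $.$; let $F\Phi$ be the free symmetric operad on $\Phi$, so that $(F\Phi)_n$ is the set of terms built from $e$ and $.$ in which each of the variables $x_0,\dots,x_{n-1}$ occurs exactly once, and let $\varphi:F\Phi\to P$ be the unique (levelwise surjective) morphism. Let $Q$ be the categorification of $P$ with respect to $(\Phi,\varphi)$, that is, the symmetric $\mathbf{Cat}$-operad in the factorization $F\Phi\to Q\to P$ of $\varphi$ into a morphism that is bijective on objects followed by a morphism that is levelwise full and faithful. Thus the objects of $Q_n$ are the elements of $(F\Phi)_n$, and there is exactly one arrow between any two of them. For a category $\mathcal C$ let $\mathrm{End}(\mathcal C)$ be the symmetric $\mathbf{Cat}$-operad with $\mathrm{End}(\mathcal C)_n=[\mathcal C^n,\mathcal C]$,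 the category of functors $\mathcal C^n\to\mathcal C$ and natural transformations, with composition by substitution and with $(\sigma\cdot G)(c_1,\dots,c_n)=G(c_{\sigma 1},\dots,c_{\sigma n})$. A $Q$-algebra structure on $\mathcal C$ is a morphism of symmetric $\mathbf{Cat}$-operads $\widehat{(\ )}:Q\to\mathrm{End}(\mathcal C)$. Theorem. Let $\mathcal C$ be a category. There are mutually inverse maps $R$, from the $Q$-algebra structures on $\mathcal C$ to the symmetric monoidal category structures on $\mathcal C$, and $S$, in the opposite direction, such that the following hold. (1) For a $Q$-algebra structure $\widehat{(\ )}$, the structure $R(\widehat{(\ )})=(\otimes,I,\alpha,\lambda,\rho,\tau)$ is given by $\otimes=\widehat{.}$, $I=\widehat e$, $\alpha=\widehat{\delta_1}$, $\lambda=\widehat{\delta_2}$, $\rho=\widehat{\delta_3}$, $\tau=\widehat{\delta_4}$, where $\delta_1:x_0.(x_1.x_2)\to(x_0.x_1).x_2$, $\delta_2:e.x_0\to x_0$, $\delta_3:x_0.e\to x_0$ and $\delta_4:x_1.x_0\to x_0.x_1$ are the unique arrows of $Q$ with these sources and targets. (2) For a symmetric monoidal structure $(\otimes,I,\alpha,\lambda,\rho,\tau)$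 on $\mathcal C$, the algebra structure $S(\otimes,I,\alpha,\lambda,\rho,\tau)=\widehat{(\ )}$ has $\widehat{.}=\otimes$ and $\widehat e=I$, and for every arrow $\delta:p\to q$ of $Q_n$ the components of $\widehat\delta:\widehat p\to\widehat q$ are canonical maps, that is, they are obtained from components of $\alpha,\lambda,\rho,\tau$, their inverses and identities by composition and $\otimes$. -/

import Mathlib

open CategoryTheory MonoidalCategory

universe v u v₁ u₁ v₂ u₂ w

namespace Categorification

/-! ### Reindexing bijections between finite ordinals

Throughout, `Fin (∑ i, k i)` is identified with the pairs `⟨i, j⟩`, `i : Fin n`, `j : Fin (k i)`, in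
lexicographic order, through `finSigmaFinEquiv`. -/

section Reindexing

/-- `∑_{i < 1} k = k`. -/
def oneSum (k : ℕ) : Fin (∑ _i : Fin 1, k) ≃ Fin k :=
  finSigmaFinEquiv.symm.trans
    ((Equiv.sigmaEquivProd (Fin 1) (Fin k)).trans (Equiv.uniqueProd (Fin k) (Fin 1)))

/-- `∑_{i < n} 1 = n`. -/
def sumOne (n : ℕ) : Fin (∑ _i : Fin n, 1) ≃ Fin n :=
  finSigmaFinEquiv.symm.trans
    ((Equiv.sigmaEquivProd (Fin n) (Fin 1)).trans (Equiv.prodUnique (Fin n) (Fin 1)))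

/-- The family `l` of arities, listed along the ordinal `∑ i, k i`. -/
def flat {n : ℕ} {k : Fin n → ℕ} (l : ∀ i, Fin (k i) → ℕ) (m : Fin (∑ i, k i)) : ℕ :=
  l (finSigmaFinEquiv.symm m).1 (finSigmaFinEquiv.symm m).2

/-- The order-preserving bijection `((i, j), t) ↦ (i, (j, t))`. -/
def sumAssoc {n : ℕ} {k : Fin n → ℕ} (l : ∀ i, Fin (k i) → ℕ) :
    Fin (∑ m, flat l m) ≃ Fin (∑ i, ∑ j, l i j) :=
  finSigmaFinEquiv.symm.trans
    ((Equiv.sigmaCongrLeft (β := fun p : (Σ i, Fin (k i)) => Fin (l p.1 p.2))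
        finSigmaFinEquiv.symm).trans
      ((Equiv.sigmaAssoc (fun i (j : Fin (k i)) => Fin (l i j))).trans
        ((Equiv.sigmaCongrRight fun _ => finSigmaFinEquiv).trans finSigmaFinEquiv)))

/-- The block permutation `σ ∘ (1, …, 1) : (i, j) ↦ (σ i, j)`. -/
def blockPerm {m n : ℕ} (σ : Fin m ≃ Fin n) (k : Fin n → ℕ) :
    Fin (∑ i, k (σ i)) ≃ Fin (∑ i, k i) :=
  finSigmaFinEquiv.symm.trans
    ((Equiv.sigmaCongrLeft (β := fun i => Fin (k i)) σ).trans finSigmaFinEquiv)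

/-- The direct sum `(i, j) ↦ (i, e i j)` of bijections. -/
def sumPerm {n : ℕ} {k l : Fin n → ℕ} (e : ∀ i, Fin (k i) ≃ Fin (l i)) :
    Fin (∑ i, k i) ≃ Fin (∑ i, l i) :=
  finSigmaFinEquiv.symm.trans ((Equiv.sigmaCongrRight e).trans finSigmaFinEquiv)

@[simp] lemma oneSum_apply (k : ℕ) (i : Fin 1) (j : Fin k) :
    oneSum k (finSigmaFinEquiv (n := fun _ => k) ⟨i, j⟩) = j := by
  simp [oneSum]

@[simp] lemma sumOne_apply (n : ℕ) (i : Fin n) (j : Fin 1) :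
    sumOne n (finSigmaFinEquiv (n := fun _ => 1) ⟨i, j⟩) = i := by
  simp [sumOne]

lemma sumAssoc_apply {n : ℕ} {k : Fin n → ℕ} (l : ∀ i, Fin (k i) → ℕ) (m : Fin (∑ i, k i))
    (t : Fin (flat l m)) :
    sumAssoc l (finSigmaFinEquiv ⟨m, t⟩) =
      finSigmaFinEquiv ⟨(finSigmaFinEquiv.symm m).1,
        finSigmaFinEquiv ⟨(finSigmaFinEquiv.symm m).2, t⟩⟩ := by
  have key : ∀ p : (Σ m, Fin (flat l m)), p = ⟨m, t⟩ →
      finSigmaFinEquiv (n := fun i => ∑ j, l i j) ⟨(finSigmaFinEquiv.symm p.1).1,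
        finSigmaFinEquiv (n := l _) ⟨(finSigmaFinEquiv.symm p.1).2, p.2⟩⟩ =
      finSigmaFinEquiv ⟨(finSigmaFinEquiv.symm m).1,
        finSigmaFinEquiv ⟨(finSigmaFinEquiv.symm m).2, t⟩⟩ := by
    rintro p rfl
    rfl
  exact key _ (Equiv.symm_apply_apply _ _)

@[simp] lemma blockPerm_apply {m n : ℕ} (σ : Fin m ≃ Fin n) (k : Fin n → ℕ) (i : Fin m)
    (j : Fin (k (σ i))) :
    blockPerm σ k (finSigmaFinEquiv (n := fun i => k (σ i)) ⟨i, j⟩) =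
      finSigmaFinEquiv ⟨σ i, j⟩ := by
  simp [blockPerm, Equiv.sigmaCongrLeft]

@[simp] lemma sumPerm_apply {n : ℕ} {k l : Fin n → ℕ} (e : ∀ i, Fin (k i) ≃ Fin (l i)) (i : Fin n)
    (j : Fin (k i)) :
    sumPerm e (finSigmaFinEquiv ⟨i, j⟩) = finSigmaFinEquiv ⟨i, e i j⟩ := by
  simp [sumPerm]

end Reindexing

/-! ### Symmetric operads in sets -/

/-- A symmetric operad (in sets).  The left actions of the symmetric groups `S_n` on the sets `P_n`
are given as an action of all bijections `Fin m ≃ Fin n`; since such a bijection exists only for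
`m = n`, these are the same data, and it lets the axioms be written without casts along equalities
of arities. -/
structure SymOperad where
  /-- the set `P_n` of `n`-ary operations -/
  Op : ℕ → Type u
  /-- the symmetric group actions -/
  map {m n : ℕ} (e : Fin m ≃ Fin n) : Op m → Op n
  map_refl (n : ℕ) (f : Op n) : map (Equiv.refl (Fin n)) f = f
  map_trans {m n p : ℕ} (e : Fin m ≃ Fin n) (e' : Fin n ≃ Fin p) (f : Op m) :
    map (e.trans e') f = map e' (map e f)
  /-- the unit element -/
  one : Op 1
  /-- operadic composition `f ∘ (g_1, …, g_n)` -/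
  comp {n : ℕ} (k : Fin n → ℕ) (f : Op n) (g : ∀ i, Op (k i)) : Op (∑ i, k i)
  one_comp (k : ℕ) (f : Op k) : map (oneSum k) (comp (fun _ : Fin 1 => k) one fun _ => f) = f
  comp_one (n : ℕ) (f : Op n) : map (sumOne n) (comp (fun _ : Fin n => 1) f fun _ => one) = f
  assoc {n : ℕ} (k : Fin n → ℕ) (l : ∀ i, Fin (k i) → ℕ) (f : Op n) (g : ∀ i, Op (k i))
    (h : ∀ i j, Op (l i j)) :
    comp (fun i => ∑ j, l i j) f (fun i => comp (l i) (g i) (h i)) =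
      map (sumAssoc l) (comp (flat l) (comp k f g)
        fun m => h (finSigmaFinEquiv.symm m).1 (finSigmaFinEquiv.symm m).2)
  comp_map_left {m n : ℕ} (σ : Fin m ≃ Fin n) (k : Fin n → ℕ) (f : Op m) (g : ∀ i, Op (k i)) :
    comp k (map σ f) g = map (blockPerm σ k) (comp (fun i => k (σ i)) f fun i => g (σ i))
  comp_map_right {n : ℕ} {k l : Fin n → ℕ} (e : ∀ i, Fin (k i) ≃ Fin (l i)) (f : Op n)
    (g : ∀ i, Op (k i)) :
    comp l f (fun i => map (e i) (g i)) = map (sumPerm e) (comp k f g)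

/-- Morphisms of symmetric operads. -/
structure SymOperad.Hom (P : SymOperad.{u₁}) (Q : SymOperad.{u₂}) where
  app (n : ℕ) : P.Op n → Q.Op n
  app_map {m n : ℕ} (e : Fin m ≃ Fin n) (f : P.Op m) : app n (P.map e f) = Q.map e (app m f)
  app_one : app 1 P.one = Q.one
  app_comp {n : ℕ} (k : Fin n → ℕ) (f : P.Op n) (g : ∀ i, P.Op (k i)) :
    app (∑ i, k i) (P.comp k f g) = Q.comp k (app n f) fun i => app (k i) (g i)

/-- The terminal symmetric operad, whose algebras are commutative monoids. -/
def terminalOperad : SymOperad.{0} where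
  Op _ := PUnit
  map _ _ := PUnit.unit
  map_refl _ _ := rfl
  map_trans _ _ _ := rfl
  one := PUnit.unit
  comp _ _ _ := PUnit.unit
  one_comp _ _ := rfl
  comp_one _ _ := rfl
  assoc _ _ _ _ _ := rfl
  comp_map_left _ _ _ _ := rfl
  comp_map_right _ _ _ := rfl

/-! ### The free symmetric operad on a sequence of sets -/

/-- Terms with variables in `L` built from the operation symbols `Φ`. -/
inductive Term (Φ : ℕ → Type w) (L : Type) : Type w
  | var : L → Term Φ L
  | op {n : ℕ} : Φ n → (Fin n → Term Φ L) → Term Φ L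

namespace Term

variable {Φ : ℕ → Type w} {L L' L'' : Type}

/-- Simultaneous substitution. -/
def bind : Term Φ L → (L → Term Φ L') → Term Φ L'
  | var l, g => g l
  | op a ts, g => op a fun i => (ts i).bind g

/-- Renaming of variables. -/
def rename (e : L → L') : Term Φ L → Term Φ L'
  | var l => var (e l)
  | op a ts => op a fun i => (ts i).rename e

/-- The number of occurrences of a variable in a term. -/
def count [DecidableEq L] (l : L) : Term Φ L → ℕ
  | var l' => if l' = l then 1 else 0
  | op _ ts => ∑ i, (ts i).count l

/-- A term is linear if every variable occurs in it exactly once. -/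
def Linear [DecidableEq L] (t : Term Φ L) : Prop := ∀ l, t.count l = 1

instance [DecidableEq L] [Fintype L] (t : Term Φ L) : Decidable t.Linear :=
  inferInstanceAs (Decidable (∀ l, t.count l = 1))

lemma rename_id (t : Term Φ L) : t.rename id = t := by
  induction t with
  | var l => rfl
  | op a ts ih => simp [rename, ih]

lemma rename_rename (e : L → L') (e' : L' → L'') (t : Term Φ L) :
    (t.rename e).rename e' = t.rename (e' ∘ e) := by
  induction t with
  | var l => rfl
  | op a ts ih => simp [rename, ih]

lemma bind_var (e : L → L') (t : Term Φ L) : (t.bind fun l => var (e l)) = t.rename e := by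
  induction t with
  | var l => rfl
  | op a ts ih => simp [bind, rename, ih]

lemma rename_bind (e : L → L') (g : L' → Term Φ L'') (t : Term Φ L) :
    (t.rename e).bind g = t.bind fun l => g (e l) := by
  induction t with
  | var l => rfl
  | op a ts ih => simp [bind, rename, ih]

lemma bind_rename (g : L → Term Φ L') (e : L' → L'') (t : Term Φ L) :
    (t.bind g).rename e = t.bind fun l => (g l).rename e := by
  induction t with
  | var l => rfl
  | op a ts ih => simp [bind, rename, ih]

lemma bind_bind (g : L → Term Φ L') (h : L' → Term Φ L'') (t : Term Φ L) :
    (t.bind g).bind h = t.bind fun l => (g l).bind h := by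
  induction t with
  | var l => rfl
  | op a ts ih => simp [bind, ih]

variable [DecidableEq L] [DecidableEq L'] [DecidableEq L'']

lemma count_bind [Fintype L] (g : L → Term Φ L') (l' : L') (t : Term Φ L) :
    (t.bind g).count l' = ∑ l, t.count l * (g l).count l' := by
  induction t with
  | var l => simp [bind, count]
  | op a ts ih =>
    simp only [bind, count, ih, Finset.sum_mul]
    exact Finset.sum_comm

lemma count_rename [Fintype L] (e : L → L') (l' : L') (t : Term Φ L) :
    (t.rename e).count l' = ∑ l, t.count l * if e l = l' then 1 else 0 := by
  rw [← bind_var, count_bind]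
  rfl

lemma Linear.rename [Fintype L] {t : Term Φ L} (ht : t.Linear) (e : L ≃ L') :
    (t.rename e).Linear := by
  intro l'
  rw [count_rename]
  simp only [ht _, one_mul]
  rw [Finset.sum_eq_single (e.symm l')]
  · simp
  · intro b _ hb
    rw [if_neg]
    rintro rfl
    simp at hb
  · simp

/-- The substitution of linear terms in disjoint sets of variables into a linear term. -/
def compose {n : ℕ} (k : Fin n → ℕ) (f : Term Φ (Fin n)) (g : ∀ i, Term Φ (Fin (k i))) :
    Term Φ (Fin (∑ i, k i)) :=
  f.bind fun i => (g i).rename fun j => finSigmaFinEquiv ⟨i, j⟩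

lemma Linear.compose {n : ℕ} {k : Fin n → ℕ} {f : Term Φ (Fin n)} {g : ∀ i, Term Φ (Fin (k i))}
    (hf : f.Linear) (hg : ∀ i, (g i).Linear) : (f.compose k g).Linear := by
  intro l
  obtain ⟨⟨i₀, j₀⟩, rfl⟩ := finSigmaFinEquiv.surjective l
  rw [Term.compose, count_bind]
  simp only [hf _, one_mul, count_rename, (hg _) _, EmbeddingLike.apply_eq_iff_eq]
  rw [Finset.sum_eq_single i₀]
  · rw [Finset.sum_eq_single j₀] <;> simp +contextual
  · intro b _ hb
    simp [hb]
  · simp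

end Term

section Free

variable (Φ : ℕ → Type w)

/-- The free symmetric operad `FΦ` on a sequence `Φ` of sets: its `n`-ary operations are the terms
built from `Φ` in which each of the variables `0, …, n - 1` occurs exactly once (equivalently:
trees with vertices labelled by `Φ` and with permuted leaves), composed by substitution. -/
def freeOperad : SymOperad.{w} where
  Op n := {t : Term Φ (Fin n) // t.Linear}
  map e t := ⟨t.1.rename e, t.2.rename e⟩
  map_refl n t := Subtype.ext (Term.rename_id t.1)
  map_trans e e' t := Subtype.ext (Term.rename_rename e e' t.1).symm
  one := ⟨.var 0, by intro l; fin_cases l; rfl⟩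
  comp k f g := ⟨f.1.compose k fun i => (g i).1, f.2.compose fun i => (g i).2⟩
  one_comp k f := by
    apply Subtype.ext
    simp only [Term.compose, Term.bind, Term.rename_rename]
    convert Term.rename_id f.1
    ext j
    simp
  comp_one n f := by
    apply Subtype.ext
    simp only [Term.compose, Term.rename, Term.bind_rename, sumOne_apply]
    exact (Term.bind_var id f.1).trans (Term.rename_id f.1)
  assoc {n} k l f g h := by
    apply Subtype.ext
    simp only [Term.compose, Term.bind_rename, Term.bind_bind, Term.rename_bind,
      Term.rename_rename]
    congr 1
    funext i
    congr 1
    funext j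
    have key : ∀ (m : Fin (∑ i, k i)) (p : Σ i, Fin (k i)), finSigmaFinEquiv.symm m = p →
        (h p.1 p.2).1.rename
          (fun t => (finSigmaFinEquiv (n := fun i => ∑ j, l i j)
            ⟨p.1, finSigmaFinEquiv (n := l p.1) ⟨p.2, t⟩⟩)) =
        (h (finSigmaFinEquiv.symm m).1 (finSigmaFinEquiv.symm m).2).1.rename
          (fun t => sumAssoc l (finSigmaFinEquiv (n := flat l) ⟨m, t⟩)) := by
      rintro m p rfl
      congr 1
      funext t
      exact (sumAssoc_apply l m t).symm
    exact key _ ⟨i, j⟩ (by simp)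
  comp_map_left σ k f g := by
    apply Subtype.ext
    simp only [Term.compose, Term.bind_rename, Term.rename_bind, Term.rename_rename]
    congr 1
    funext i
    congr 1
    funext j
    simp
  comp_map_right e f g := by
    apply Subtype.ext
    simp only [Term.compose, Term.bind_rename, Term.rename_rename]
    congr 1
    funext i
    congr 1
    funext j
    simp

end Free

/-- A signature `(Φ, φ)` for a symmetric operad `P`: a sequence of sets `Φ` and a regular epimorphism
(that is, a levelwise surjective morphism) `φ : FΦ → P`. -/
structure Signature (P : SymOperad.{u}) where
  ops : ℕ → Type w
  hom : (freeOperad ops).Hom P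
  surjective (n : ℕ) : Function.Surjective (hom.app n)

/-- The standard signature for commutative monoids: one nullary operation, one binary operation. -/
inductive CommOp : ℕ → Type
  | unit : CommOp 0
  | mul : CommOp 2

namespace CommOp

variable {L : Type}

/-- The term `e`. -/
def e : Term CommOp L := .op .unit ![]

/-- The term `s . t`. -/
def dot (s t : Term CommOp L) : Term CommOp L := .op .mul ![s, t]

/-- A linear term in `n` variables. -/
def comb : ∀ n : ℕ, Term CommOp (Fin n)
  | 0 => e
  | n + 1 => dot (.var 0) ((comb n).rename Fin.succ)

lemma comb_linear (n : ℕ) : (comb n).Linear := by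
  induction n with
  | zero => exact fun l => l.elim0
  | succ n ih =>
    intro l
    refine Fin.cases ?_ (fun l => ?_) l
    · simp [comb, dot, Term.count, Term.count_rename]
    · simp only [comb, dot, Term.count, Term.count_rename, ih _, Fin.sum_univ_two,
        Matrix.cons_val_zero, Matrix.cons_val_one, Fin.succ_inj, one_mul]
      simp [(Fin.succ_ne_zero l).symm]

end CommOp

/-- The standard signature for the terminal symmetric operad. -/
def commSignature : Signature.{0, 0} terminalOperad where
  ops := CommOp
  hom :=
    { app := fun _ _ => PUnit.unit
      app_map := fun _ _ => rfl
      app_one := rfl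
      app_comp := fun _ _ _ => rfl }
  surjective n _ := ⟨⟨CommOp.comb n, CommOp.comb_linear n⟩, rfl⟩

/-! ### Symmetric operads in categories -/

/-- A symmetric `Cat`-operad: the notion of symmetric operad interpreted in categories and functors
with their cartesian products. -/
structure SymCatOperad where
  /-- the category `P_n` -/
  Op : ℕ → Type u
  [cat (n : ℕ) : Category.{v} (Op n)]
  /-- the symmetric group actions -/
  map {m n : ℕ} (e : Fin m ≃ Fin n) : Op m ⥤ Op n
  map_refl (n : ℕ) : map (Equiv.refl (Fin n)) = 𝟭 (Op n)
  map_trans {m n p : ℕ} (e : Fin m ≃ Fin n) (e' : Fin n ≃ Fin p) :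
    map (e.trans e') = map e ⋙ map e'
  /-- the unit -/
  one : Op 1
  /-- operadic composition -/
  comp {n : ℕ} (k : Fin n → ℕ) : Op n × (∀ i, Op (k i)) ⥤ Op (∑ i, k i)
  one_comp (k : ℕ) :
    Functor.prod' ((Functor.const (Op k)).obj one) (Functor.pi' fun _ : Fin 1 => 𝟭 (Op k)) ⋙
      comp (fun _ : Fin 1 => k) ⋙ map (oneSum k) = 𝟭 (Op k)
  comp_one (n : ℕ) :
    Functor.prod' (𝟭 (Op n)) (Functor.pi' fun _ : Fin n => (Functor.const (Op n)).obj one) ⋙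
      comp (fun _ : Fin n => 1) ⋙ map (sumOne n) = 𝟭 (Op n)
  /-- `f ∘ (g_i ∘ (h_{ij})_j)_i = (f ∘ (g_i)_i) ∘ (h_{ij})_{ij}`, as functors of
  `(f, (g_i)_i, (h_{ij})_{ij})` -/
  assoc {n : ℕ} (k : Fin n → ℕ) (l : ∀ i, Fin (k i) → ℕ) :
    (Functor.prod' (CategoryTheory.Prod.fst _ _)
      (Functor.pi' fun i =>
        Functor.prod'
          (CategoryTheory.Prod.snd _ _ ⋙ CategoryTheory.Prod.fst _ _ ⋙ Pi.eval _ i)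
          (CategoryTheory.Prod.snd _ _ ⋙ CategoryTheory.Prod.snd _ _ ⋙ Pi.eval _ i) ⋙
        comp (l i)) ⋙
      comp (fun i => ∑ j, l i j) :
        Op n × (∀ i, Op (k i)) × (∀ i j, Op (l i j)) ⥤ Op (∑ i, ∑ j, l i j)) =
    Functor.prod'
        (Functor.prod' (CategoryTheory.Prod.fst _ _)
          (CategoryTheory.Prod.snd _ _ ⋙ CategoryTheory.Prod.fst _ _) ⋙ comp k)
        (Functor.pi' fun m =>
          CategoryTheory.Prod.snd _ _ ⋙ CategoryTheory.Prod.snd _ _ ⋙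
            Pi.eval _ (finSigmaFinEquiv.symm m).1 ⋙ Pi.eval _ (finSigmaFinEquiv.symm m).2) ⋙
      comp (flat l) ⋙ map (sumAssoc l)
  comp_map_left {m n : ℕ} (σ : Fin m ≃ Fin n) (k : Fin n → ℕ) :
    (map σ).prod (𝟭 (∀ i, Op (k i))) ⋙ comp k =
      (𝟭 (Op m)).prod (Pi.comap (fun i => Op (k i)) σ) ⋙ comp (fun i => k (σ i)) ⋙
        map (blockPerm σ k)
  comp_map_right {n : ℕ} {k l : Fin n → ℕ} (e : ∀ i, Fin (k i) ≃ Fin (l i)) :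
    (𝟭 (Op n)).prod (Functor.pi fun i => map (e i)) ⋙ comp l = comp k ⋙ map (sumPerm e)

attribute [instance] SymCatOperad.cat

/-- Morphisms of symmetric `Cat`-operads. -/
@[ext]
structure SymCatOperad.Hom (P : SymCatOperad.{v₁, u₁}) (Q : SymCatOperad.{v₂, u₂}) where
  app (n : ℕ) : P.Op n ⥤ Q.Op n
  app_map {m n : ℕ} (e : Fin m ≃ Fin n) : P.map e ⋙ app n = app m ⋙ Q.map e
  app_one : (app 1).obj P.one = Q.one
  app_comp {n : ℕ} (k : Fin n → ℕ) :
    P.comp k ⋙ app (∑ i, k i) = (app n).prod (Functor.pi fun i => app (k i)) ⋙ Q.comp k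

/-- The composite of two morphisms of symmetric `Cat`-operads. -/
def SymCatOperad.Hom.trans {P : SymCatOperad.{v, u}} {Q : SymCatOperad.{v₁, u₁}}
    {R : SymCatOperad.{v₂, u₂}} (f : P.Hom Q) (g : Q.Hom R) : P.Hom R where
  app n := f.app n ⋙ g.app n
  app_map e := by
    rw [← Functor.assoc, f.app_map, Functor.assoc, g.app_map, Functor.assoc]
  app_one := by simp [f.app_one, g.app_one]
  app_comp k := by
    rw [← Functor.assoc, f.app_comp, Functor.assoc, g.app_comp]
    rfl

lemma functor_eq_of_thin {A : Type u₁} [Category.{v₁} A] {B : Type u₂} [Category.{v₂} B]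
    [Quiver.IsThin B] {F G : A ⥤ B} (h : ∀ X, F.obj X = G.obj X) : F = G :=
  CategoryTheory.Functor.ext h fun _ _ _ => Subsingleton.elim _ _

/-- A symmetric operad in sets, viewed as a symmetric `Cat`-operad with discrete categories of
operations. -/
def SymOperad.discrete (P : SymOperad.{u}) : SymCatOperad.{u, u} where
  Op n := Discrete (P.Op n)
  map e := Discrete.functor fun f => ⟨P.map e f⟩
  map_refl n := functor_eq_of_thin fun f => Discrete.ext (P.map_refl n f.as)
  map_trans e e' := functor_eq_of_thin fun f => Discrete.ext (P.map_trans e e' f.as)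
  one := ⟨P.one⟩
  comp k :=
    { obj := fun f => ⟨P.comp k f.1.as fun i => (f.2 i).as⟩
      map := fun {f f'} h => Discrete.eqToHom (by
        have h1 := Discrete.eq_of_hom h.1
        have h2 := fun i => Discrete.eq_of_hom (h.2 i)
        simp [h1, h2]) }
  one_comp k := functor_eq_of_thin fun f => Discrete.ext (P.one_comp k f.as)
  comp_one n := functor_eq_of_thin fun f => Discrete.ext (P.comp_one n f.as)
  assoc k l := functor_eq_of_thin fun f => Discrete.ext
    (P.assoc k l f.1.as (fun i => (f.2.1 i).as) fun i j => (f.2.2 i j).as)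
  comp_map_left σ k := functor_eq_of_thin fun f => Discrete.ext
    (P.comp_map_left σ k f.1.as fun i => (f.2 i).as)
  comp_map_right e := functor_eq_of_thin fun f => Discrete.ext
    (P.comp_map_right e f.1.as fun i => (f.2 i).as)

/-- The morphism of discrete symmetric `Cat`-operads given by a morphism of symmetric operads. -/
def SymOperad.Hom.discrete {P : SymOperad.{u₁}} {Q : SymOperad.{u₂}} (f : P.Hom Q) :
    P.discrete.Hom Q.discrete where
  app n := Discrete.functor fun p => ⟨f.app n p⟩
  app_map e := functor_eq_of_thin (B := Discrete _) fun p => Discrete.ext (f.app_map e p.as)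
  app_one := Discrete.ext f.app_one
  app_comp k := functor_eq_of_thin (B := Discrete _) fun p => Discrete.ext
    (f.app_comp k p.1.as fun i => (p.2 i).as)

/-! ### Categorification -/

namespace Signature

variable {P : SymOperad.{u}} (S : Signature.{u, w} P)

/-- The objects of the categorification in arity `n` are those of `FΦ`; an arrow `s ⟶ t` is an
arrow `φ s ⟶ φ t` of the discrete category `P_n`. -/
abbrev CatOp (n : ℕ) : Type w :=
  InducedCategory (Discrete (P.Op n)) fun t : (freeOperad S.ops).Op n => ⟨S.hom.app n t⟩

instance (n : ℕ) : Quiver.IsThin (S.CatOp n) := fun _ _ =>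
  ⟨fun f g => InducedCategory.hom_ext (Subsingleton.elim f.hom g.hom)⟩

variable {S}

/-- The arrow between two terms with the same value in `P`. -/
def arrow {n : ℕ} {s t : S.CatOp n} (h : S.hom.app n s = S.hom.app n t) : s ⟶ t :=
  InducedCategory.homMk (Discrete.eqToHom h)

lemma eq_of_arrow {n : ℕ} {s t : S.CatOp n} (h : s ⟶ t) : S.hom.app n s = S.hom.app n t :=
  Discrete.eq_of_hom h.hom

variable (S)

/-- The categorification `Q` of `P` with respect to the signature `(Φ, φ)`: the middle object of the
factorization of `φ` into a morphism `FΦ → Q` which is bijective on objects followed by a morphism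
`Q → P` which is levelwise full and faithful. -/
def categorification : SymCatOperad.{u, w} where
  Op n := S.CatOp n
  map e :=
    { obj := fun t => (freeOperad S.ops).map e t
      map := fun {s t} h => arrow (by
        rw [S.hom.app_map, S.hom.app_map, eq_of_arrow h])
      map_id := fun _ => Subsingleton.elim _ _
      map_comp := fun _ _ => Subsingleton.elim _ _ }
  map_refl n := functor_eq_of_thin fun t => (freeOperad S.ops).map_refl n t
  map_trans e e' := functor_eq_of_thin fun t => (freeOperad S.ops).map_trans e e' t
  one := (freeOperad S.ops).one
  comp k :=
    { obj := fun t => (freeOperad S.ops).comp k t.1 t.2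
      map := fun {s t} h => arrow (by
        have h1 := eq_of_arrow h.1
        have h2 := fun i => eq_of_arrow (h.2 i)
        rw [S.hom.app_comp, S.hom.app_comp, h1]
        simp only [h2])
      map_id := fun _ => Subsingleton.elim _ _
      map_comp := fun _ _ => Subsingleton.elim _ _ }
  one_comp k := functor_eq_of_thin fun t => (freeOperad S.ops).one_comp k t
  comp_one n := functor_eq_of_thin fun t => (freeOperad S.ops).comp_one n t
  assoc k l := functor_eq_of_thin fun t => (freeOperad S.ops).assoc k l t.1 t.2.1 t.2.2
  comp_map_left σ k := functor_eq_of_thin fun t => (freeOperad S.ops).comp_map_left σ k t.1 t.2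
  comp_map_right e := functor_eq_of_thin fun t => (freeOperad S.ops).comp_map_right e t.1 t.2

/-- The morphism `FΦ → Q`. -/
def toCategorification : (freeOperad S.ops).discrete.Hom S.categorification where
  app n := Discrete.functor (C := S.CatOp n) fun t => t
  app_map _ := functor_eq_of_thin (B := S.CatOp _) fun _ => rfl
  app_one := rfl
  app_comp _ := functor_eq_of_thin (B := S.CatOp _) fun _ => rfl

/-- The morphism `Q → P`. -/
def ofCategorification : S.categorification.Hom P.discrete where
  app n := inducedFunctor _
  app_map e := functor_eq_of_thin (B := Discrete _) fun t => Discrete.ext (S.hom.app_map e t)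
  app_one := Discrete.ext S.hom.app_one
  app_comp k := functor_eq_of_thin (B := Discrete _) fun t =>
    Discrete.ext (S.hom.app_comp k t.1 t.2)

/-- `Q` does factor `φ` as a morphism bijective on objects followed by a levelwise full and faithful
one. -/
theorem categorification_spec :
    S.toCategorification.trans S.ofCategorification = S.hom.discrete ∧
      (∀ n, Function.Bijective (S.toCategorification.app n).obj) ∧
      ∀ n, (S.ofCategorification.app n).Full ∧ (S.ofCategorification.app n).Faithful := by
  refine ⟨?_, fun _ => ?_, fun _ => ?_⟩
  · apply SymCatOperad.Hom.ext
    funext _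
    exact functor_eq_of_thin (B := Discrete _) fun _ => rfl
  · exact ⟨fun s t h => Discrete.ext h, fun t => ⟨⟨t⟩, rfl⟩⟩
  · exact ⟨InducedCategory.full _, InducedCategory.faithful _⟩

end Signature

/-! ### The endomorphism operad of a category and algebras -/

section Endomorphism

variable (C : Type u) [Category.{v} C]

/-- Precomposition of `F : C^I ⥤ C` with reindexing: `x ↦ F (i ↦ x (y i))`. -/
def reindex {I J : Type} (y : I → J) : ((I → C) ⥤ C) ⥤ ((J → C) ⥤ C) where
  obj F := Pi.comap (fun _ : J => C) y ⋙ F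
  map α := Functor.whiskerLeft _ α

/-- The composite `x ↦ F (i ↦ G i x)`. -/
def superpose {I : Type} (X : Type u₁) [Category.{v₁} X] :
    ((I → C) ⥤ C) × (I → (X ⥤ C)) ⥤ (X ⥤ C) where
  obj F := Functor.pi' F.2 ⋙ F.1
  map α := Functor.whiskerRight (NatTrans.pi' α.2) _ ≫ Functor.whiskerLeft _ α.1
  map_id F := by
    ext x
    exact (Category.comp_id _).trans (F.1.map_id _)
  map_comp {F F' F''} α β := by
    ext x
    have h1 := F.1.map_comp (X := fun i => (F.2 i).obj x) (Y := fun i => (F'.2 i).obj x)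
      (Z := fun i => (F''.2 i).obj x) (fun i => (α.2 i).app x) (fun i => (β.2 i).app x)
    have h2 := α.1.naturality (X := fun i => (F'.2 i).obj x) (Y := fun i => (F''.2 i).obj x)
      (fun i => (β.2 i).app x)
    refine (congrArg (· ≫ (α.1.app _ ≫ β.1.app _)) h1).trans ?_
    refine (Category.assoc _ _ _).trans ?_
    refine Eq.trans ?_ (Category.assoc _ _ _).symm
    refine congrArg _ ?_
    refine (Category.assoc _ _ _).symm.trans ?_
    refine (congrArg (· ≫ β.1.app _) h2).trans ?_
    exact Category.assoc _ _ _

/-- The composite `x ↦ F (i ↦ G i (j ↦ x (y i j)))`. -/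
def substitute {I J : Type} {K : I → Type} (y : ∀ i, K i → J) :
    ((I → C) ⥤ C) × (∀ i, (K i → C) ⥤ C) ⥤ ((J → C) ⥤ C) :=
  (𝟭 _).prod (Functor.pi fun i => reindex C (y i)) ⋙ superpose C (J → C)

variable {C}

lemma substitute_one {K J : Type} (y : Fin 1 → K → J) (e : J → K) (h : ∀ i j, e (y i j) = j) :
    Functor.prod' ((Functor.const ((K → C) ⥤ C)).obj (Pi.eval (fun _ : Fin 1 => C) 0))
        (Functor.pi' fun _ : Fin 1 => 𝟭 ((K → C) ⥤ C)) ⋙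
      substitute C y ⋙ reindex C e = 𝟭 ((K → C) ⥤ C) := by
  have key : ∀ z : Fin 1 → K → K, z = (fun _ j => j) →
      Functor.prod' ((Functor.const ((K → C) ⥤ C)).obj (Pi.eval (fun _ : Fin 1 => C) 0))
        (Functor.pi' fun _ : Fin 1 => 𝟭 ((K → C) ⥤ C)) ⋙
      substitute C z = 𝟭 ((K → C) ⥤ C) := by
    rintro z rfl
    refine Functor.hext (fun _ => rfl) fun F G α => heq_of_eq ?_
    ext x
    exact Category.comp_id _
  exact key (fun i j => e (y i j)) (by funext i j; exact h i j)

lemma substitute_var {I J : Type} (y : I → Fin 1 → J) (e : J → I) (h : ∀ i j, e (y i j) = i) :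
    Functor.prod' (𝟭 ((I → C) ⥤ C))
        (Functor.pi' fun _ : I =>
          (Functor.const ((I → C) ⥤ C)).obj (Pi.eval (fun _ : Fin 1 => C) 0)) ⋙
      substitute C y ⋙ reindex C e = 𝟭 ((I → C) ⥤ C) := by
  have key : ∀ z : I → Fin 1 → I, z = (fun i _ => i) →
      Functor.prod' (𝟭 ((I → C) ⥤ C))
        (Functor.pi' fun _ : I =>
          (Functor.const ((I → C) ⥤ C)).obj (Pi.eval (fun _ : Fin 1 => C) 0)) ⋙
      substitute C z = 𝟭 ((I → C) ⥤ C) := by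
    rintro z rfl
    refine Functor.hext (fun _ => rfl) fun F G α => heq_of_eq ?_
    ext x
    exact (congrArg (· ≫ α.app x) (F.map_id x)).trans (Category.id_comp _)
  exact key (fun i j => e (y i j)) (by funext i j; exact h i j)

lemma substitute_map_left {I I' J J' : Type} {K : I' → Type} (σ : I → I') (y : ∀ i, K i → J')
    (y' : ∀ i, K (σ i) → J) (e : J → J') (h : ∀ i j, e (y' i j) = y (σ i) j) :
    (reindex C σ).prod (𝟭 (∀ i, (K i → C) ⥤ C)) ⋙ substitute C y =
      (𝟭 ((I → C) ⥤ C)).prod (Pi.comap (fun i => (K i → C) ⥤ C) σ) ⋙ substitute C y' ⋙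
        reindex C e := by
  have key : ∀ z : (∀ i, K (σ i) → J'), z = (fun i j => y (σ i) j) →
      (reindex C σ).prod (𝟭 (∀ i, (K i → C) ⥤ C)) ⋙ substitute C y =
      (𝟭 ((I → C) ⥤ C)).prod (Pi.comap (fun i => (K i → C) ⥤ C) σ) ⋙ substitute C z := by
    rintro z rfl
    rfl
  exact key (fun i j => e (y' i j)) (by funext i j; exact h i j)

lemma substitute_map_right {I J J' : Type} {K K' : I → Type} (e : ∀ i, K i → K' i)
    (y : ∀ i, K i → J) (y' : ∀ i, K' i → J') (e' : J → J')
    (h : ∀ i j, e' (y i j) = y' i (e i j)) :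
    (𝟭 ((I → C) ⥤ C)).prod (Functor.pi fun i => reindex C (e i)) ⋙ substitute C y' =
      substitute C y ⋙ reindex C e' := by
  have key : ∀ z : (∀ i, K i → J'), z = (fun i j => y' i (e i j)) →
      (𝟭 ((I → C) ⥤ C)).prod (Functor.pi fun i => reindex C (e i)) ⋙ substitute C y' =
        substitute C z := by
    rintro z rfl
    rfl
  exact key (fun i j => e' (y i j)) (by funext i j; exact h i j)

lemma substitute_assoc {I M N J : Type} {K : I → Type} {B : I → Type} {L : ∀ i, K i → Type}
    (p : M → Σ i, K i) (y₁ : ∀ i, B i → J) (y₂ : ∀ i j, L i j → B i) (y₃ : ∀ i, K i → M)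
    (y₄ : ∀ m, L (p m).1 (p m).2 → N) (e : N → J)
    (hp : ∀ i j, p (y₃ i j) = ⟨i, j⟩)
    (he : ∀ m t, e (y₄ m t) = y₁ (p m).1 (y₂ (p m).1 (p m).2 t)) :
    (Functor.prod' (CategoryTheory.Prod.fst _ _)
      (Functor.pi' fun i =>
        Functor.prod'
          (CategoryTheory.Prod.snd _ _ ⋙ CategoryTheory.Prod.fst _ _ ⋙ Pi.eval _ i)
          (CategoryTheory.Prod.snd _ _ ⋙ CategoryTheory.Prod.snd _ _ ⋙ Pi.eval _ i) ⋙
        substitute C (y₂ i)) ⋙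
      substitute C y₁ :
        ((I → C) ⥤ C) × (∀ i, (K i → C) ⥤ C) × (∀ i j, (L i j → C) ⥤ C) ⥤ ((J → C) ⥤ C)) =
    Functor.prod'
        (Functor.prod' (CategoryTheory.Prod.fst _ _)
          (CategoryTheory.Prod.snd _ _ ⋙ CategoryTheory.Prod.fst _ _) ⋙ substitute C y₃)
        (Functor.pi' fun m =>
          CategoryTheory.Prod.snd _ _ ⋙ CategoryTheory.Prod.snd _ _ ⋙
            Pi.eval _ (p m).1 ⋙ Pi.eval _ (p m).2) ⋙
      substitute C y₄ ⋙ reindex C e := by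
  -- both sides are `x ↦ f (i ↦ g i (j ↦ W i j x))` for a family `W`
  let D := ((I → C) ⥤ C) × (∀ i, (K i → C) ⥤ C) × (∀ i j, (L i j → C) ⥤ C)
  let W : (Σ i, K i) → (D ⥤ ((J → C) ⥤ C)) := fun q =>
    CategoryTheory.Prod.snd _ _ ⋙ CategoryTheory.Prod.snd _ _ ⋙ Pi.eval _ q.1 ⋙ Pi.eval _ q.2 ⋙
      reindex C (fun t => y₁ q.1 (y₂ q.1 q.2 t))
  let big : (∀ i, K i → Σ i, K i) → (D ⥤ ((J → C) ⥤ C)) := fun q =>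
    Functor.prod' (CategoryTheory.Prod.fst _ _)
      (Functor.pi' fun i =>
        Functor.prod' (CategoryTheory.Prod.snd _ _ ⋙ CategoryTheory.Prod.fst _ _ ⋙ Pi.eval _ i)
          (Functor.pi' fun j => W (q i j)) ⋙ superpose C (J → C)) ⋙
      superpose C (J → C)
  have key : ∀ z : (∀ m, L (p m).1 (p m).2 → J),
      z = (fun m t => y₁ (p m).1 (y₂ (p m).1 (p m).2 t)) →
      big (fun i j => p (y₃ i j)) = Functor.prod'
        (Functor.prod' (CategoryTheory.Prod.fst _ _)
          (CategoryTheory.Prod.snd _ _ ⋙ CategoryTheory.Prod.fst _ _) ⋙ substitute C y₃)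
        (Functor.pi' fun m =>
          CategoryTheory.Prod.snd _ _ ⋙ CategoryTheory.Prod.snd _ _ ⋙
            Pi.eval _ (p m).1 ⋙ Pi.eval _ (p m).2) ⋙
      substitute C z := by
    rintro z rfl
    refine Functor.hext (fun _ => rfl) fun F G α => heq_of_eq ?_
    ext x
    have h1 := F.1.map_comp
      (X := fun i => (F.2.1 i).obj fun j => ((W (p (y₃ i j))).obj F).obj x)
      (Y := fun i => (F.2.1 i).obj fun j => ((W (p (y₃ i j))).obj G).obj x)
      (Z := fun i => (G.2.1 i).obj fun j => ((W (p (y₃ i j))).obj G).obj x)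
      (fun i => (F.2.1 i).map fun j => ((W (p (y₃ i j))).map α).app x)
      (fun i => (α.2.1 i).app fun j => ((W (p (y₃ i j))).obj G).obj x)
    exact (congrArg (· ≫ α.1.app fun i => (G.2.1 i).obj fun j =>
      ((W (p (y₃ i j))).obj G).obj x) h1).trans (Category.assoc _ _ _)
  have h₀ : (fun i j => p (y₃ i j)) = fun i j => ⟨i, j⟩ := by funext i j; exact hp i j
  refine Eq.trans ?_ (key (fun m t => e (y₄ m t)) (by funext m t; exact he m t))
  rw [h₀]
  rfl

variable (C)

/-- The endomorphism operad `End(C)`: `End(C)_n` is the category of functors `C^n ⥤ C`, the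
symmetric groups permute the arguments, `(σ · F)(x_1, …, x_n) = F(x_{σ 1}, …, x_{σ n})`, and
composition is `(F ∘ G)(x) = F(i ↦ G_i(j ↦ x_{ij}))`. -/
def endOperad : SymCatOperad.{max u v, max u v} where
  Op n := (Fin n → C) ⥤ C
  map e := reindex C e
  map_refl _ := rfl
  map_trans _ _ := rfl
  one := Pi.eval (fun _ : Fin 1 => C) 0
  comp k := substitute C fun i j => finSigmaFinEquiv ⟨i, j⟩
  one_comp k := substitute_one _ _ (oneSum_apply k)
  comp_one n := substitute_var _ _ (sumOne_apply n)
  assoc k l := substitute_assoc (K := fun i => Fin (k i))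
    (L := fun i j => Fin (l i j)) finSigmaFinEquiv.symm _ _ _ _ _
    (fun _ _ => Equiv.symm_apply_apply _ _) (sumAssoc_apply l)
  comp_map_left σ k := substitute_map_left (K := fun i => Fin (k i)) σ _ _ _ (blockPerm_apply σ k)
  comp_map_right {_ k l} e := substitute_map_right (K := fun i => Fin (k i))
    (K' := fun i => Fin (l i)) (fun i => e i) _ _ _ (sumPerm_apply e)

/-- A `P`-algebra structure on the category `C`: a morphism of symmetric `Cat`-operads
`P → End(C)`. -/
abbrev AlgebraStructure (P : SymCatOperad.{v₁, u₁}) := P.Hom (endOperad C)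

end Endomorphism

/-! ### Commutative monoids and symmetric monoidal categories -/

/-- The categorification of the terminal symmetric operad with respect to the standard signature. -/
abbrev commCat : SymCatOperad.{0, 0} := commSignature.categorification

/-- A linear term as an operation of `commCat`. -/
def ofTerm {n : ℕ} (t : Term CommOp (Fin n)) (h : t.Linear) : commCat.Op n := ⟨t, h⟩

/-- The linear term underlying an operation of `commCat`. -/
def toTerm {n : ℕ} (p : commCat.Op n) : Term CommOp (Fin n) := p.1

/-- The unique arrow between two `n`-ary operations of `commCat`. -/
def commArrow {n : ℕ} (s t : commCat.Op n) : s ⟶ t := Signature.arrow rfl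

namespace CommOp

/-- `e`, as an object of `Q_0`. -/
def unitQ : commCat.Op 0 := ofTerm e (by decide)

/-- `x₀`, as an object of `Q_1`. -/
def idQ : commCat.Op 1 := ofTerm (.var 0) (by decide)

/-- `x₀ . x₁`, as an object of `Q_2`. -/
def mulQ : commCat.Op 2 := ofTerm (dot (.var 0) (.var 1)) (by decide)

/-- `(12) · (x₀ . x₁) = x₁ . x₀`, as an object of `Q_2`. -/
def swapQ : commCat.Op 2 := ofTerm (dot (.var 1) (.var 0)) (by decide)

/-- `e . x₀`, as an object of `Q_1`. -/
def unitMulQ : commCat.Op 1 := ofTerm (dot e (.var 0)) (by decide)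

/-- `x₀ . e`, as an object of `Q_1`. -/
def mulUnitQ : commCat.Op 1 := ofTerm (dot (.var 0) e) (by decide)

/-- `x₀ . (x₁ . x₂)`, as an object of `Q_3`. -/
def assocRightQ : commCat.Op 3 := ofTerm (dot (.var 0) (dot (.var 1) (.var 2))) (by decide)

/-- `(x₀ . x₁) . x₂`, as an object of `Q_3`. -/
def assocLeftQ : commCat.Op 3 := ofTerm (dot (dot (.var 0) (.var 1)) (.var 2)) (by decide)

end CommOp

section SymmetricMonoidal

variable (C : Type u) [Category.{v} C]

/-- A symmetric monoidal category structure on the category `C`. -/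
structure SymMonStructure where
  monoidal : MonoidalCategory C
  symmetric : SymmetricCategory C

variable {C}

/-- The symmetric monoidal structure `M = (⊗, I, α, λ, ρ, τ)` is the one read off from the algebra
structure `A = (^)`: `⊗` and `I` are the values of `.` and `e`, and `α`, `λ`, `ρ`, `τ` are the values
of the arrows `δ₁ : x₀ . (x₁ . x₂) ⟶ (x₀ . x₁) . x₂`, `δ₂ : e . x₀ ⟶ x₀`, `δ₃ : x₀ . e ⟶ x₀`,
`δ₄ : x₁ . x₀ ⟶ x₀ . x₁` of `Q`.  Two arrows of `C` are compared as elements of `Arrow C`, that is,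
together with their sources and targets.  (In Mathlib `α_ X Y Z` goes from `(X ⊗ Y) ⊗ Z` to
`X ⊗ (Y ⊗ Z)`, so that `α` here is its inverse.) -/
structure ReadOff (A : AlgebraStructure C commCat) (M : SymMonStructure C) : Prop where
  tensorObj (x : Fin 2 → C) :
    letI := M.monoidal
    x 0 ⊗ x 1 = ((A.app 2).obj CommOp.mulQ).obj x
  tensorHom {x y : Fin 2 → C} (f : x ⟶ y) :
    letI := M.monoidal
    Arrow.mk (f 0 ⊗ₘ f 1) = Arrow.mk (((A.app 2).obj CommOp.mulQ).map f)
  unit (x : Fin 0 → C) :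
    letI := M.monoidal
    𝟙_ C = ((A.app 0).obj CommOp.unitQ).obj x
  associator (x : Fin 3 → C) :
    letI := M.monoidal
    Arrow.mk (α_ (x 0) (x 1) (x 2)).inv =
      Arrow.mk (((A.app 3).map (commArrow CommOp.assocRightQ CommOp.assocLeftQ)).app x)
  leftUnitor (x : Fin 1 → C) :
    letI := M.monoidal
    Arrow.mk (λ_ (x 0)).hom =
      Arrow.mk (((A.app 1).map (commArrow CommOp.unitMulQ CommOp.idQ)).app x)
  rightUnitor (x : Fin 1 → C) :
    letI := M.monoidal
    Arrow.mk (ρ_ (x 0)).hom =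
      Arrow.mk (((A.app 1).map (commArrow CommOp.mulUnitQ CommOp.idQ)).app x)
  braiding (x : Fin 2 → C) :
    letI := M.monoidal
    letI := M.symmetric
    Arrow.mk (β_ (x 1) (x 0)).hom =
      Arrow.mk (((A.app 2).map (commArrow CommOp.swapQ CommOp.mulQ)).app x)

section Canonical

variable [MonoidalCategory C] {L : Type}

/-- The value of a term in a monoidal category, at a valuation of its variables. -/
def value (x : L → C) : Term CommOp L → C
  | .var l => x l
  | .op .unit _ => 𝟙_ C
  | .op .mul ts => value x (ts 0) ⊗ value x (ts 1)

open CommOp in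
/-- The canonical maps between the values of terms at a valuation: those obtained from the
components of `α`, `λ`, `ρ`, `τ`, their inverses and identities by composing and tensoring. -/
inductive IsCanonical [SymmetricCategory C] (x : L → C) :
    ∀ s t : Term CommOp L, (value x s ⟶ value x t) → Prop
  | id (s) : IsCanonical x s s (𝟙 _)
  | comp {s t r f g} : IsCanonical x s t f → IsCanonical x t r g → IsCanonical x s r (f ≫ g)
  | tensor {s s' t t' f g} : IsCanonical x s s' f → IsCanonical x t t' g →
      IsCanonical x (dot s t) (dot s' t') (f ⊗ₘ g)
  | associator_hom (s t r) : IsCanonical x (dot (dot s t) r) (dot s (dot t r))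
      (α_ (value x s) (value x t) (value x r)).hom
  | associator_inv (s t r) : IsCanonical x (dot s (dot t r)) (dot (dot s t) r)
      (α_ (value x s) (value x t) (value x r)).inv
  | leftUnitor_hom (s) : IsCanonical x (dot e s) s (λ_ (value x s)).hom
  | leftUnitor_inv (s) : IsCanonical x s (dot e s) (λ_ (value x s)).inv
  | rightUnitor_hom (s) : IsCanonical x (dot s e) s (ρ_ (value x s)).hom
  | rightUnitor_inv (s) : IsCanonical x s (dot s e) (ρ_ (value x s)).inv
  | braiding (s t) : IsCanonical x (dot s t) (dot t s) (β_ (value x s) (value x t)).hom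

end Canonical

/-- The algebra structure `A = (^)` is the one built from the symmetric monoidal structure
`M = (⊗, I, α, λ, ρ, τ)`: the functors `q̂` are determined by `⊗` and `I`, and for an arrow
`δ : p ⟶ q` of `Q` the components of `δ̂ : p̂ ⟶ q̂` are canonical maps. -/
structure BuiltFrom (M : SymMonStructure C) (A : AlgebraStructure C commCat) : Prop where
  unit (x : Fin 0 → C) :
    letI := M.monoidal
    ((A.app 0).obj CommOp.unitQ).obj x = 𝟙_ C
  mul {x y : Fin 2 → C} (f : x ⟶ y) :
    letI := M.monoidal
    Arrow.mk (((A.app 2).obj CommOp.mulQ).map f) = Arrow.mk (f 0 ⊗ₘ f 1)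
  canonical {n : ℕ} {p q : commCat.Op n} (δ : p ⟶ q) (x : Fin n → C) :
    letI := M.monoidal
    letI := M.symmetric
    ∃ θ : value x (toTerm p) ⟶ value x (toTerm q), IsCanonical x (toTerm p) (toTerm q) θ ∧
      Arrow.mk (((A.app n).map δ).app x) = Arrow.mk θ

end SymmetricMonoidal

end Categorification

/-!
# Algebras of the categorified commutative operad are symmetric monoidal categories

The content of the theorem is Mac Lane's coherence theorem, in both directions.

From a symmetric monoidal category to an algebra.  An operation of `Q` acts by evaluating its term,
and an arrow of `Q` by the canonical map between the values of its source and target.  For this to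
be defined and to respect composition and substitution there must be exactly one canonical map
between the values of two linear terms with the same variables.  Existence and uniqueness both come from
normal forms: a term `t` acts on the maps `A ⟶ N` into right-nested products of variables listed in
increasing order, producing such a map out of `t ⊗ A`, by inserting the variables of `t` one after
the other at their places (`act`).  The insertions of two distinct variables commute up to the
braiding by the Yang–Baxter equation (`Normalized.insert_insert`), and the pentagon, triangle and
hexagon identities extend this to terms, so that every canonical map between terms without repeated
variables intertwines the two actions (`IsCanonical.intertwines`).  Acting on the unit object, this
determines the canonical map (`IsCanonical.unique`).

From an algebra to a symmetric monoidal category.  The tensor product, the unit and the structural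
isomorphisms are the values of the corresponding operations and arrows of `Q`.  The arrows of `C`
that are values of arrows of `Q`, at a substitution instance of their terms, are closed under
composition and tensor products and are determined by their terms, because `Q` has only one arrow
between any two operations of the same arity (`AlgebraStructure.Structural.comp`,
`AlgebraStructure.Structural.unique`).  Hence every coherence diagram commutes.

The same closure properties show that the canonical maps of the monoidal category obtained from an
algebra are the values of the arrows of `Q`, so the algebra is recovered; and a symmetric monoidal
structure is determined by the data read off from an algebra (`ReadOff.unique`).

Arrows of `C` whose sources and targets agree only propositionally are compared as elements of
`Arrow C`.
-/

namespace Categorification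

/-! ### Exchanging the two outer factors of `X ⊗ (Y ⊗ A)` -/

section Exchange

variable {C : Type u} [Category.{v} C] [MonoidalCategory C] [SymmetricCategory C]

/-- The canonical map `X ⊗ (Y ⊗ A) ⟶ Y ⊗ (X ⊗ A)`. -/
def exchange (X Y A : C) : X ⊗ (Y ⊗ A) ⟶ Y ⊗ (X ⊗ A) :=
  (α_ X Y A).inv ≫ (β_ X Y).hom ▷ A ≫ (α_ Y X A).hom

lemma exchange_exchange (X Y A : C) : exchange X Y A ≫ exchange Y X A = 𝟙 _ := by
  simp [exchange, ← comp_whiskerRight_assoc]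

lemma exchange_naturality (X Y : C) {A B : C} (f : A ⟶ B) :
    X ◁ Y ◁ f ≫ exchange X Y B = exchange X Y A ≫ Y ◁ X ◁ f := by
  simp only [exchange, Category.assoc, associator_inv_naturality_right_assoc,
    whisker_exchange_assoc, associator_naturality_right]

lemma whiskerRight_eq_exchange (X Y A : C) :
    (β_ X Y).hom ▷ A ≫ (α_ Y X A).hom = (α_ X Y A).hom ≫ exchange X Y A := by
  simp [exchange]

lemma exchange_unit (Y A : C) :
    exchange (𝟙_ C) Y A ≫ Y ◁ (λ_ A).hom = (λ_ (Y ⊗ A)).hom := by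
  simp only [exchange, Category.assoc, braiding_tensorUnit_left, comp_whiskerRight]
  monoidal

lemma exchange_tensor (X X' Y A : C) :
    exchange (X ⊗ X') Y A ≫ Y ◁ (α_ X X' A).hom =
      (α_ X X' (Y ⊗ A)).hom ≫ X ◁ exchange X' Y A ≫ exchange X Y (X' ⊗ A) := by
  simp only [exchange, BraidedCategory.braiding_tensor_left_hom]
  monoidal

/-- The Yang–Baxter equation for the exchange maps. -/
lemma exchange_yangBaxter (X Y Z A : C) :
    X ◁ exchange Y Z A ≫ exchange X Z (Y ⊗ A) ≫ Z ◁ exchange X Y A =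
      exchange X Y (Z ⊗ A) ≫ Y ◁ exchange X Z A ≫ exchange Y Z (X ⊗ A) := by
  simp only [exchange]
  calc
    _ = 𝟙 _ ⊗≫ (X ◁ (β_ Y Z).hom ≫ (α_ X Z Y).inv ≫ (β_ X Z).hom ▷ Y ≫
          (α_ Z X Y).hom ≫ Z ◁ (β_ X Y).hom) ▷ A ⊗≫ 𝟙 _ := by monoidal
    _ = _ := by
      rw [← BraidedCategory.yang_baxter]
      monoidal

end Exchange

/-! ### Terms over the standard signature -/

section Terms

variable {L : Type}

open CommOp

@[elab_as_elim]
lemma CommOp.induction {motive : Term CommOp L → Prop} (var : ∀ l, motive (.var l))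
    (e : motive e) (dot : ∀ s t, motive s → motive t → motive (dot s t)) (t : Term CommOp L) :
    motive t := by
  induction t with
  | var l => exact var l
  | op a ts ih =>
    cases a with
    | unit => exact (Subsingleton.elim ![] ts) ▸ e
    | mul =>
      have h : ![ts 0, ts 1] = ts := by
        funext i
        fin_cases i <;> rfl
      exact h ▸ dot (ts 0) (ts 1) (ih 0) (ih 1)

variable [DecidableEq L]

@[simp] lemma count_e (l : L) : (e : Term CommOp L).count l = 0 := rfl

@[simp] lemma count_dot (s t : Term CommOp L) (l : L) :
    (dot s t).count l = s.count l + t.count l := by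
  simp [dot, Term.count, Fin.sum_univ_two]

/-- A term is affine if every variable occurs in it at most once. -/
def Term.Affine (t : Term CommOp L) : Prop := ∀ l, t.count l ≤ 1

lemma Term.Linear.affine {t : Term CommOp L} (h : t.Linear) : t.Affine := fun l => (h l).le

lemma Term.Affine.left {s t : Term CommOp L} (h : (dot s t).Affine) : s.Affine := fun l => by
  have := h l
  rw [count_dot] at this
  omega

lemma Term.Affine.right {s t : Term CommOp L} (h : (dot s t).Affine) : t.Affine := fun l => by
  have := h l
  rw [count_dot] at this
  omega

lemma Term.Affine.disjoint {s t : Term CommOp L} (h : (dot s t).Affine) (l : L) :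
    s.count l = 0 ∨ t.count l = 0 := by
  have := h l
  rw [count_dot] at this
  omega

end Terms

/-! ### Normal forms -/

section NormalForm

variable {L : Type}

/-- The right-nested product of the variables of a list, ended by the unit. -/
def listTerm : List L → Term CommOp L
  | [] => CommOp.e
  | l :: m => CommOp.dot (.var l) (listTerm m)

variable {C : Type u} [Category.{v} C] [MonoidalCategory C] (x : L → C)

/-- A map out of `A` whose target is the value of a right-nested product of variables.  The list of
variables is part of the data, so that normal forms are compared without transport along equalities
of lists. -/
abbrev Normalized (A : C) : Type v := Σ m : List L, (A ⟶ value x (listTerm m))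

variable {x}

namespace Normalized

/-- Precomposition. -/
def pre {A B : C} (f : A ⟶ B) (p : Normalized x B) : Normalized x A := ⟨p.1, f ≫ p.2⟩

lemma pre_pre {A B D : C} (f : A ⟶ B) (g : B ⟶ D) (p : Normalized x D) :
    (p.pre g).pre f = p.pre (f ≫ g) :=
  congrArg (Sigma.mk p.1) (Category.assoc _ _ _).symm

lemma pre_id {A : C} (p : Normalized x A) : p.pre (𝟙 A) = p :=
  congrArg (Sigma.mk p.1) (Category.id_comp _)

variable (x) in
/-- The identity of a normal form. -/
def refl (m : List L) : Normalized x (value x (listTerm m)) := ⟨m, 𝟙 _⟩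

lemma pre_refl {A : C} (p : Normalized x A) : (refl x p.1).pre p.2 = p :=
  congrArg (Sigma.mk p.1) (Category.comp_id _)

/-- Adding a variable at the head of the normal form. -/
def cons (l : L) {A : C} (p : Normalized x A) : Normalized x (x l ⊗ A) :=
  ⟨l :: p.1, x l ◁ p.2⟩

lemma cons_pre (l : L) {A B : C} (f : A ⟶ B) (p : Normalized x B) :
    (p.pre f).cons l = (p.cons l).pre (x l ◁ f) :=
  congrArg (Sigma.mk _) (whiskerLeft_comp _ _ _)

lemma cons_refl (l : L) (m : List L) : (refl x m).cons l = refl x (l :: m) :=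
  congrArg (Sigma.mk _) (whiskerLeft_id _ _)

variable [SymmetricCategory C] [LinearOrder L]

variable (x) in
/-- The insertion of a variable into a normal form, at its place for the order: the variable is
exchanged with the smaller ones that precede that place. -/
def insertion (l : L) : (m : List L) → Normalized x (x l ⊗ value x (listTerm m))
  | [] => refl x [l]
  | a :: m =>
    if l ≤ a then refl x (l :: a :: m) else ((insertion l m).cons a).pre (exchange (x l) (x a) _)

/-- The action of a variable on maps into normal forms, by insertion. -/
def insert (l : L) {A : C} (p : Normalized x A) : Normalized x (x l ⊗ A) :=
  (insertion x l p.1).pre (x l ◁ p.2)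

lemma insert_pre (l : L) {A B : C} (f : A ⟶ B) (p : Normalized x B) :
    (p.pre f).insert l = (p.insert l).pre (x l ◁ f) := by
  rw [insert, insert, pre_pre, ← whiskerLeft_comp]
  rfl

lemma insert_nil (l : L) : (refl x []).insert l = (refl x []).cons l := by
  rw [cons_refl]
  exact (congrArg (fun f => pre f (insertion x l [])) (whiskerLeft_id _ _)).trans (pre_id _)

lemma insert_cons_of_le {l a : L} (h : l ≤ a) {A : C} (p : Normalized x A) :
    (p.cons a).insert l = (p.cons a).cons l := by
  have h1 : insertion x l (a :: p.1) = refl x (l :: a :: p.1) := if_pos h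
  rw [insert, cons, h1]
  exact pre_refl (p := (p.cons a).cons l)

lemma insert_cons_of_lt {l a : L} (h : a < l) {A : C} (p : Normalized x A) :
    (p.cons a).insert l = ((p.insert l).cons a).pre (exchange (x l) (x a) A) := by
  have h1 : insertion x l (a :: p.1) =
      ((insertion x l p.1).cons a).pre (exchange (x l) (x a) _) := if_neg h.not_ge
  refine (congrArg (pre _) h1).trans ((pre_pre _ _ _).trans ?_)
  rw [insert, cons_pre, pre_pre, ← exchange_naturality]
  rfl

lemma insert_insert_cons {l a : L} (h : l < a) (b : L) {A : C} (p : Normalized x A)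
    (hp : (p.insert a).insert l = ((p.insert l).insert a).pre (exchange (x l) (x a) A)) :
    ((p.cons b).insert a).insert l =
      (((p.cons b).insert l).insert a).pre (exchange (x l) (x a) (x b ⊗ A)) := by
  rcases le_or_gt l b with hb | hb
  · rw [insert_cons_of_le hb, insert_cons_of_lt h, pre_pre, exchange_exchange, pre_id]
    rcases le_or_gt a b with hab | hab
    · rw [insert_cons_of_le hab, insert_cons_of_le h.le]
    · rw [insert_cons_of_lt hab, insert_pre, insert_cons_of_le hb, cons_pre]
  · rw [insert_cons_of_lt (hb.trans h), insert_cons_of_lt hb, insert_pre, insert_pre,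
      insert_cons_of_lt hb, insert_cons_of_lt (hb.trans h), hp, cons_pre, pre_pre, pre_pre,
      pre_pre, pre_pre, Category.assoc, Category.assoc, exchange_yangBaxter]

/-- The insertions of two variables commute: for a normal form whose head precedes both variables,
this is the Yang–Baxter equation. -/
lemma insert_insert_of_lt {l a : L} (h : l < a) (m : List L) :
    ((refl x m).insert a).insert l =
      (((refl x m).insert l).insert a).pre (exchange (x l) (x a) _) := by
  induction m with
  | nil =>
    rw [insert_nil, insert_nil, insert_cons_of_le h.le, insert_cons_of_lt h, pre_pre,
      exchange_exchange, pre_id, insert_nil]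
  | cons b m ih =>
    have key : ∀ q : Normalized x (x b ⊗ value x (listTerm m)), q = (refl x m).cons b →
        (q.insert a).insert l =
          ((q.insert l).insert a).pre (exchange (x l) (x a) _) := by
      rintro _ rfl
      exact insert_insert_cons h b _ ih
    exact key _ (cons_refl b m).symm

lemma insert_insert {l a : L} (h : l ≠ a) {A : C} (p : Normalized x A) :
    (p.insert a).insert l = ((p.insert l).insert a).pre (exchange (x l) (x a) A) := by
  have key : ((refl x p.1).insert a).insert l =
      (((refl x p.1).insert l).insert a).pre (exchange (x l) (x a) _) := by
    rcases h.lt_or_gt with h | h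
    · exact insert_insert_of_lt h p.1
    · rw [insert_insert_of_lt h p.1, pre_pre, exchange_exchange, pre_id]
  rw [← pre_refl p]
  simp only [insert_pre, key, pre_pre, exchange_naturality]

end Normalized

variable (x) in
/-- A family of operations taking maps `A ⟶ N` into normal forms to maps `X ⊗ A ⟶ N'` into normal
forms, natural in `A`.  Actions are indexed by objects of `C` and not by terms, so that the monoidal
identities apply to them without unfolding the values of terms. -/
structure NormalAction [LinearOrder L] (X : C) where
  /-- the operation -/
  app {A : C} : Normalized x A → Normalized x (X ⊗ A)
  app_pre {A B : C} (f : A ⟶ B) (p : Normalized x B) : app (p.pre f) = (app p).pre (X ◁ f)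

namespace NormalAction

open Normalized

variable [LinearOrder L] {X X' Y Y' Z : C}

/-- The action of the unit object. -/
def unit : NormalAction x (𝟙_ C) where
  app {A} p := p.pre (λ_ A).hom
  app_pre f p := by rw [pre_pre, pre_pre, leftUnitor_naturality]

/-- The action of a tensor product. -/
def tensor (F : NormalAction x X) (G : NormalAction x Y) : NormalAction x (X ⊗ Y) where
  app {A} p := (F.app (G.app p)).pre (α_ X Y A).hom
  app_pre f p := by rw [G.app_pre, F.app_pre, pre_pre, pre_pre, associator_naturality_right]

/-- The action of a variable, by insertion. -/
def ofVar [SymmetricCategory C] (l : L) : NormalAction x (x l) where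
  app p := p.insert l
  app_pre f p := insert_pre l f p

/-- The map `f` is compatible with the actions of its source and target. -/
def Intertwines (f : X ⟶ Y) (F : NormalAction x X) (G : NormalAction x Y) : Prop :=
  ∀ (A : C) (p : Normalized x A), F.app p = (G.app p).pre (f ▷ A)

lemma Intertwines.id (F : NormalAction x X) : Intertwines (𝟙 X) F F := fun _ p => by
  rw [id_whiskerRight, pre_id]

lemma Intertwines.comp {f : X ⟶ Y} {g : Y ⟶ Z} {F : NormalAction x X} {G : NormalAction x Y}
    {H : NormalAction x Z} (hf : Intertwines f F G) (hg : Intertwines g G H) :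
    Intertwines (f ≫ g) F H := fun _ p => by
  rw [hf, hg, pre_pre, comp_whiskerRight]

lemma Intertwines.of_inverse {f : X ⟶ Y} {g : Y ⟶ X} {F : NormalAction x X} {G : NormalAction x Y}
    (hf : Intertwines f F G) (h : g ≫ f = 𝟙 Y) : Intertwines g G F := fun _ p => by
  rw [hf, pre_pre, ← comp_whiskerRight, h, id_whiskerRight, pre_id]

lemma Intertwines.tensor {f : X ⟶ X'} {g : Y ⟶ Y'} {F : NormalAction x X} {F' : NormalAction x X'}
    {G : NormalAction x Y} {G' : NormalAction x Y'} (hf : Intertwines f F F')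
    (hg : Intertwines g G G') :
    Intertwines (f ⊗ₘ g) (F.tensor G) (F'.tensor G') := fun A p => by
  change (F.app (G.app p)).pre _ = ((F'.app (G'.app p)).pre _).pre _
  rw [hg, hf, F'.app_pre, pre_pre, pre_pre, pre_pre,
    MonoidalCategory.tensorHom_def]
  congr 1
  monoidal

lemma intertwines_associator (F : NormalAction x X) (G : NormalAction x Y) (H : NormalAction x Z) :
    Intertwines (α_ X Y Z).hom ((F.tensor G).tensor H) (F.tensor (G.tensor H)) := fun A p => by
  change ((F.app (G.app (H.app p))).pre _).pre _ =
    ((F.app ((G.app (H.app p)).pre _)).pre _).pre _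
  rw [F.app_pre, pre_pre, pre_pre, pre_pre, Category.assoc, pentagon]

lemma intertwines_leftUnitor (F : NormalAction x X) :
    Intertwines (λ_ X).hom (unit.tensor F) F := fun A p => by
  change ((F.app p).pre _).pre _ = _
  rw [pre_pre]
  congr 1
  monoidal

lemma intertwines_rightUnitor (F : NormalAction x X) :
    Intertwines (ρ_ X).hom (F.tensor unit) F := fun A p => by
  change (F.app (p.pre _)).pre _ = _
  rw [F.app_pre, pre_pre, triangle]

variable [SymmetricCategory C]

/-- Two actions commute up to the exchange map. -/
def Commute (F : NormalAction x X) (G : NormalAction x Y) : Prop :=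
  ∀ (A : C) (p : Normalized x A), F.app (G.app p) = (G.app (F.app p)).pre (exchange X Y A)

lemma Commute.symm {F : NormalAction x X} {G : NormalAction x Y} (h : Commute F G) :
    Commute G F := fun _ p => by
  rw [h, pre_pre, exchange_exchange, pre_id]

lemma Commute.unit (G : NormalAction x Y) : Commute unit G := fun A p => by
  change (G.app p).pre _ = (G.app (p.pre _)).pre _
  rw [G.app_pre, pre_pre, exchange_unit]

lemma Commute.tensor {F : NormalAction x X} {F' : NormalAction x X'} {G : NormalAction x Y}
    (h : Commute F G) (h' : Commute F' G) : Commute (F.tensor F') G := fun A p => by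
  change (F.app (F'.app (G.app p))).pre _ = (G.app ((F.app (F'.app p)).pre _)).pre _
  rw [h', F.app_pre, h, G.app_pre, pre_pre, pre_pre, pre_pre, Category.assoc, exchange_tensor]

lemma Commute.intertwines_braiding {F : NormalAction x X} {G : NormalAction x Y} (h : Commute F G) :
    Intertwines (β_ X Y).hom (F.tensor G) (G.tensor F) := fun A p => by
  change (F.app (G.app p)).pre _ = ((G.app (F.app p)).pre _).pre _
  rw [h, pre_pre, pre_pre, whiskerRight_eq_exchange]

end NormalAction

variable [SymmetricCategory C] [LinearOrder L]

variable (x) in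
/-- The action of a term on maps into normal forms: its variables are inserted, from the last to the
first. -/
def act : (t : Term CommOp L) → NormalAction x (value x t)
  | .var l => .ofVar l
  | .op .unit _ => .unit
  | .op .mul ts => (act (ts 0)).tensor (act (ts 1))

/-- Terms without common variables act in a commuting way. -/
lemma commute_act (s t : Term CommOp L) (h : ∀ l, s.count l = 0 ∨ t.count l = 0) :
    (act x s).Commute (act x t) := by
  induction s using CommOp.induction with
  | var l =>
    apply NormalAction.Commute.symm
    induction t using CommOp.induction with
    | var a =>
      refine fun _ p => Normalized.insert_insert (fun hal => ?_) p
      subst hal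
      simpa [Term.count] using h a
    | e => exact NormalAction.Commute.unit _
    | dot s t hs ht =>
      simp only [count_dot, Nat.add_eq_zero_iff] at h
      exact NormalAction.Commute.tensor (hs fun a => (h a).imp id And.left)
        (ht fun a => (h a).imp id And.right)
  | e => exact NormalAction.Commute.unit _
  | dot s s' hs hs' =>
    simp only [count_dot, Nat.add_eq_zero_iff] at h
    exact NormalAction.Commute.tensor (hs fun a => (h a).imp And.left id)
      (hs' fun a => (h a).imp And.right id)

end NormalForm

/-! ### Coherence for symmetric monoidal categories -/

section Coherence

variable {L : Type} {C : Type u} [Category.{v} C] [MonoidalCategory C]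

lemma tensorHom_comp_eq_id {X X' Y Y' : C} {f : X ⟶ X'} {f' : X' ⟶ X} {g : Y ⟶ Y'} {g' : Y' ⟶ Y}
    (hf : f ≫ f' = 𝟙 X) (hg : g ≫ g' = 𝟙 Y) : (f ⊗ₘ g) ≫ (f' ⊗ₘ g') = 𝟙 (X ⊗ Y) := by
  rw [tensorHom_comp_tensorHom, hf, hg, id_tensorHom_id]

variable [SymmetricCategory C] {x : L → C}

lemma IsCanonical.count_eq [DecidableEq L] {s t : Term CommOp L} {f : value x s ⟶ value x t}
    (h : IsCanonical x s t f) (l : L) : s.count l = t.count l := by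
  induction h with
  | id s => rfl
  | comp _ _ h₁ h₂ => exact h₁.trans h₂
  | tensor _ _ h₁ h₂ => simp only [count_dot, h₁, h₂]
  | _ => simp only [count_dot, count_e]; omega

lemma IsCanonical.affine [DecidableEq L] {s t : Term CommOp L} {f : value x s ⟶ value x t}
    (h : IsCanonical x s t f) (hs : s.Affine) : t.Affine :=
  fun l => h.count_eq l ▸ hs l

lemma IsCanonical.exists_inverse {s t : Term CommOp L} {f : value x s ⟶ value x t}
    (h : IsCanonical x s t f) : ∃ g, IsCanonical x t s g ∧ f ≫ g = 𝟙 _ ∧ g ≫ f = 𝟙 _ := by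
  induction h with
  | id s => exact ⟨_, .id s, Category.id_comp _, Category.id_comp _⟩
  | comp _ _ h₁ h₂ =>
    obtain ⟨g₁, c₁, l₁, r₁⟩ := h₁
    obtain ⟨g₂, c₂, l₂, r₂⟩ := h₂
    refine ⟨_, c₂.comp c₁, ?_, ?_⟩
    · rw [Category.assoc, reassoc_of% l₂, l₁]
    · rw [Category.assoc, reassoc_of% r₁, r₂]
  | tensor _ _ h₁ h₂ =>
    obtain ⟨g₁, c₁, l₁, r₁⟩ := h₁
    obtain ⟨g₂, c₂, l₂, r₂⟩ := h₂
    exact ⟨_, c₁.tensor c₂, tensorHom_comp_eq_id l₁ l₂, tensorHom_comp_eq_id r₁ r₂⟩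
  | associator_hom s t r => exact ⟨_, .associator_inv s t r, Iso.hom_inv_id _, Iso.inv_hom_id _⟩
  | associator_inv s t r => exact ⟨_, .associator_hom s t r, Iso.inv_hom_id _, Iso.hom_inv_id _⟩
  | leftUnitor_hom s => exact ⟨_, .leftUnitor_inv s, Iso.hom_inv_id _, Iso.inv_hom_id _⟩
  | leftUnitor_inv s => exact ⟨_, .leftUnitor_hom s, Iso.inv_hom_id _, Iso.hom_inv_id _⟩
  | rightUnitor_hom s => exact ⟨_, .rightUnitor_inv s, Iso.hom_inv_id _, Iso.inv_hom_id _⟩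
  | rightUnitor_inv s => exact ⟨_, .rightUnitor_hom s, Iso.inv_hom_id _, Iso.hom_inv_id _⟩
  | braiding s t =>
    exact ⟨_, .braiding t s, SymmetricCategory.symmetry _ _, SymmetricCategory.symmetry _ _⟩

lemma IsCanonical.isIso {s t : Term CommOp L} {f : value x s ⟶ value x t}
    (h : IsCanonical x s t f) : IsIso f :=
  let ⟨g, _, hg⟩ := h.exists_inverse
  ⟨g, hg⟩

lemma IsCanonical.whiskerLeft {s t : Term CommOp L} {f : value x s ⟶ value x t}
    (h : IsCanonical x s t f) (r : Term CommOp L) :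
    IsCanonical x (CommOp.dot r s) (CommOp.dot r t) (value x r ◁ f) := by
  have e : 𝟙 (value x r) ⊗ₘ f = value x r ◁ f := id_tensorHom _ _
  exact (congrArg (IsCanonical x (CommOp.dot r s) (CommOp.dot r t)) e).mp
    ((IsCanonical.id r).tensor h)

lemma IsCanonical.whiskerRight {s t : Term CommOp L} {f : value x s ⟶ value x t}
    (h : IsCanonical x s t f) (r : Term CommOp L) :
    IsCanonical x (CommOp.dot s r) (CommOp.dot t r) (f ▷ value x r) := by
  have e : f ⊗ₘ 𝟙 (value x r) = f ▷ value x r := tensorHom_id _ _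
  exact (congrArg (IsCanonical x (CommOp.dot s r) (CommOp.dot t r)) e).mp
    (h.tensor (IsCanonical.id r))

lemma isCanonical_exchange (s t r : Term CommOp L) :
    IsCanonical x (CommOp.dot s (CommOp.dot t r)) (CommOp.dot t (CommOp.dot s r))
      (exchange (value x s) (value x t) (value x r)) :=
  (IsCanonical.associator_inv s t r).comp
    (((IsCanonical.braiding s t).whiskerRight r).comp (.associator_hom t s r))

variable [LinearOrder L]

open Normalized Categorification.NormalAction

/-- Canonical maps between affine terms are compatible with the actions on normal forms. -/
lemma IsCanonical.intertwines {s t : Term CommOp L} {f : value x s ⟶ value x t}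
    (h : IsCanonical x s t f) (hs : s.Affine) : Intertwines f (act x s) (act x t) := by
  induction h with
  | id s => exact .id _
  | comp h₁ _ ih₁ ih₂ => exact (ih₁ hs).comp (ih₂ (h₁.affine hs))
  | tensor _ _ ih₁ ih₂ => exact (ih₁ hs.left).tensor (ih₂ hs.right)
  | associator_hom s t r => exact intertwines_associator _ _ _
  | associator_inv s t r => exact (intertwines_associator _ _ _).of_inverse (Iso.inv_hom_id _)
  | leftUnitor_hom s => exact intertwines_leftUnitor _
  | leftUnitor_inv s => exact (intertwines_leftUnitor _).of_inverse (Iso.inv_hom_id _)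
  | rightUnitor_hom s => exact intertwines_rightUnitor _
  | rightUnitor_inv s => exact (intertwines_rightUnitor _).of_inverse (Iso.inv_hom_id _)
  | braiding s t => exact (commute_act s t hs.disjoint).intertwines_braiding

lemma insertion_cons (l a : L) (m : List L) :
    insertion x l (a :: m) = if l ≤ a then Normalized.refl x (l :: a :: m) else
      ((insertion x l m).cons a).pre (exchange (x l) (x a) _) := rfl

lemma isCanonical_insertion (l : L) (m : List L) :
    IsCanonical x (CommOp.dot (.var l) (listTerm m)) (listTerm (insertion x l m).1)
      (insertion x l m).2 := by
  induction m with
  | nil => exact .id _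
  | cons a m ih =>
    by_cases h : l ≤ a
    · rw [(insertion_cons l a m).trans (if_pos h)]
      exact .id _
    · rw [(insertion_cons l a m).trans (if_neg h)]
      exact (isCanonical_exchange (.var l) (.var a) (listTerm m)).comp (ih.whiskerLeft (.var a))

lemma isCanonical_act (s : Term CommOp L) {r : Term CommOp L} (p : Normalized x (value x r))
    (hp : IsCanonical x r (listTerm p.1) p.2) :
    IsCanonical x (CommOp.dot s r) (listTerm ((act x s).app p).1) ((act x s).app p).2 := by
  induction s using CommOp.induction generalizing r with
  | var l => exact (hp.whiskerLeft (.var l)).comp (isCanonical_insertion l p.1)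
  | e => exact (IsCanonical.leftUnitor_hom r).comp hp
  | dot s t hs ht => exact (IsCanonical.associator_hom s t r).comp (hs _ (ht _ hp))

/-- Any two canonical maps between affine terms are equal: both are determined by the actions on
normal forms.  Affinity is needed, since for a variable `l` the braiding of `l` with itself need not
be the identity. -/
theorem IsCanonical.unique {s t : Term CommOp L} {f g : value x s ⟶ value x t}
    (hf : IsCanonical x s t f) (hg : IsCanonical x s t g) (hs : s.Affine) : f = g := by
  let u : Normalized x (𝟙_ C) := Normalized.refl x []
  have h : ((act x t).app u).pre (f ▷ 𝟙_ C) = ((act x t).app u).pre (g ▷ 𝟙_ C) :=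
    (hf.intertwines hs _ u).symm.trans (hg.intertwines hs _ u)
  have : IsIso ((act x t).app u).2 := (isCanonical_act (r := CommOp.e) t u (.id _)).isIso
  have h' := eq_of_heq (Sigma.mk.inj h).2
  exact (whiskerRight_iff f g).1 ((cancel_mono ((act x t).app u).2).1 h')

lemma insertion_fst (l : L) (m : List L) :
    (insertion x l m).1 = m.orderedInsert (· ≤ ·) l := by
  induction m with
  | nil => rfl
  | cons a m ih =>
    by_cases h : l ≤ a
    · rw [(insertion_cons l a m).trans (if_pos h), List.orderedInsert_cons, if_pos h]
      rfl
    · rw [(insertion_cons l a m).trans (if_neg h), List.orderedInsert_cons, if_neg h]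
      exact congrArg (a :: ·) ih

lemma pairwise_act_fst (s : Term CommOp L) {A : C} (p : Normalized x A)
    (hp : p.1.Pairwise (· ≤ ·)) : ((act x s).app p).1.Pairwise (· ≤ ·) := by
  induction s using CommOp.induction generalizing A with
  | var l =>
    change (insertion x l p.1).1.Pairwise _
    rw [insertion_fst]
    exact hp.orderedInsert l _
  | e => exact hp
  | dot s t hs ht => exact hs _ (ht _ hp)

lemma count_act_fst (s : Term CommOp L) {A : C} (p : Normalized x A) (a : L) :
    ((act x s).app p).1.count a = s.count a + p.1.count a := by
  induction s using CommOp.induction generalizing A with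
  | var l =>
    change (insertion x l p.1).1.count a = _
    rw [insertion_fst, (List.perm_orderedInsert _ l p.1).count_eq, List.count_cons, Term.count,
      add_comm]
    simp only [beq_iff_eq]
  | e => exact (Nat.zero_add _).symm
  | dot s t hs ht =>
    rw [count_dot, add_assoc, ← ht, ← hs]
    rfl

/-- There is a canonical map between any two terms with the same variables: both have the same
sorted normal form. -/
theorem exists_isCanonical (x : L → C) {s t : Term CommOp L} (h : ∀ l, s.count l = t.count l) :
    ∃ f, IsCanonical x s t f := by
  have toNormalForm (r : Term CommOp L) :
      ∃ f, IsCanonical x r (listTerm ((act x r).app (Normalized.refl x [])).1) f :=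
    ⟨_, (IsCanonical.rightUnitor_inv r).comp
      (isCanonical_act (r := CommOp.e) r (Normalized.refl x []) (.id _))⟩
  have hl : ((act x s).app (Normalized.refl x [])).1 =
      ((act x t).app (Normalized.refl x [])).1 := by
    refine List.Perm.eq_of_pairwise' (r := (· ≤ ·)) ?_ ?_ (List.perm_iff_count.2 fun a => ?_)
    · exact pairwise_act_fst s _ .nil
    · exact pairwise_act_fst t _ .nil
    · rw [count_act_fst, count_act_fst, h]
  obtain ⟨f, hf⟩ := toNormalForm s
  obtain ⟨g, hg⟩ := hl ▸ toNormalForm t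
  obtain ⟨g', hg', -⟩ := hg.exists_inverse
  exact ⟨_, hf.comp hg'⟩

end Coherence

/-! ### Arrows compared together with their sources and targets -/

section Arrows

variable {C : Type u} [Category.{v} C]

/-- Composition respects equality of arrows up to replacing their sources and targets by equal
objects. -/
lemma arrow_comp_congr {X Y Z X' Y' Z' : C} {f : X ⟶ Y} {g : Y ⟶ Z} {f' : X' ⟶ Y'} {g' : Y' ⟶ Z'}
    (hf : Arrow.mk f = Arrow.mk f') (hg : Arrow.mk g = Arrow.mk g') :
    Arrow.mk (f ≫ g) = Arrow.mk (f' ≫ g') := by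
  obtain rfl : X = X' := congrArg (·.left) hf
  obtain rfl : Y = Y' := congrArg (·.right) hf
  obtain rfl : Z = Z' := congrArg (·.right) hg
  rw [Arrow.mk_inj] at hf hg
  rw [hf, hg]

lemma arrow_tensor_congr [MonoidalCategory C] {X Y Z W X' Y' Z' W' : C} {f : X ⟶ Y} {g : Z ⟶ W}
    {f' : X' ⟶ Y'} {g' : Z' ⟶ W'} (hf : Arrow.mk f = Arrow.mk f') (hg : Arrow.mk g = Arrow.mk g') :
    Arrow.mk (f ⊗ₘ g) = Arrow.mk (f' ⊗ₘ g') := by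
  obtain rfl : X = X' := congrArg (·.left) hf
  obtain rfl : Y = Y' := congrArg (·.right) hf
  obtain rfl : Z = Z' := congrArg (·.left) hg
  obtain rfl : W = W' := congrArg (·.right) hg
  rw [Arrow.mk_inj] at hf hg
  rw [hf, hg]

lemma arrow_natTrans_ext {D : Type u₁} [Category.{v₁} D] {F G F' G' : D ⥤ C} {α : F ⟶ G}
    {β : F' ⟶ G'} (hF : F = F') (hG : G = G')
    (h : ∀ x, Arrow.mk (α.app x) = Arrow.mk (β.app x)) : Arrow.mk α = Arrow.mk β := by
  subst hF hG
  rw [Arrow.mk_inj]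
  ext x
  exact (Arrow.mk_inj _ _).1 (h x)

lemma arrow_square_congr {X Y Z W X' Y' Z' W' : C} {f : X ⟶ Y}
    {g : Y ⟶ Z} {h : X ⟶ W} {k : W ⟶ Z} {f' : X' ⟶ Y'} {g' : Y' ⟶ Z'} {h' : X' ⟶ W'} {k' : W' ⟶ Z'}
    (H : f' ≫ g' = h' ≫ k') (hf : Arrow.mk f = Arrow.mk f') (hg : Arrow.mk g = Arrow.mk g')
    (hh : Arrow.mk h = Arrow.mk h') (hk : Arrow.mk k = Arrow.mk k') : f ≫ g = h ≫ k :=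
  (Arrow.mk_inj _ _).1 <|
    (arrow_comp_congr hf hg).trans ((congrArg Arrow.mk H).trans (arrow_comp_congr hh hk).symm)

/-- An isomorphism between given objects equal to its source and target. -/
def castIso {X Y X' Y' : C} (e : X' ≅ Y') (h : X = X') (h' : Y = Y') :
    X ≅ Y :=
  eqToIso h ≪≫ e ≪≫ eqToIso h'.symm

lemma castIso_hom {X Y X' Y' : C} (e : X' ≅ Y') (h : X = X')
    (h' : Y = Y') : Arrow.mk (castIso e h h').hom = Arrow.mk e.hom := by
  subst h h'
  simp [castIso]

lemma castIso_inv {X Y X' Y' : C} (e : X' ≅ Y') (h : X = X')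
    (h' : Y = Y') : Arrow.mk (castIso e h h').inv = Arrow.mk e.inv := by
  subst h h'
  simp [castIso]

end Arrows

/-! ### The functors given by terms -/

section Bind

variable {L L' : Type}

@[simp] lemma bind_e (g : L → Term CommOp L') : (CommOp.e : Term CommOp L).bind g = CommOp.e :=
  congrArg (Term.op CommOp.unit) (Subsingleton.elim _ _)

@[simp] lemma bind_dot (s t : Term CommOp L) (g : L → Term CommOp L') :
    (CommOp.dot s t).bind g = CommOp.dot (s.bind g) (t.bind g) := by
  refine congrArg (Term.op CommOp.mul) (funext fun i => ?_)
  fin_cases i <;> rfl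

end Bind

section Interpretation

variable {C : Type u} [Category.{v} C] {L L' : Type}

/-- The functor `C^L ⥤ C` given by a term, for an interpretation of the binary symbol by a functor
and of the nullary symbol by an object. -/
def interp (T : (Fin 2 → C) ⥤ C) (I : C) : Term CommOp L → ((L → C) ⥤ C)
  | .var l => Pi.eval (fun _ => C) l
  | .op .unit _ => (Functor.const _).obj I
  | .op .mul ts => Functor.pi' (fun i => interp T I (ts i)) ⋙ T

lemma interp_bind (T : (Fin 2 → C) ⥤ C) (I : C) (t : Term CommOp L) (g : L → Term CommOp L') :
    interp T I (t.bind g) = Functor.pi' (fun l => interp T I (g l)) ⋙ interp T I t := by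
  induction t with
  | var l => rfl
  | op a ts ih =>
    cases a with
    | unit => rfl
    | mul =>
      change Functor.pi' (fun i => interp T I ((ts i).bind g)) ⋙ T = _
      rw [show (fun i => interp T I ((ts i).bind g)) = _ from funext ih]
      rfl

lemma interp_rename (T : (Fin 2 → C) ⥤ C) (I : C) (t : Term CommOp L) (e : L → L') :
    interp T I (t.rename e) = (reindex C e).obj (interp T I t) := by
  rw [← Term.bind_var, interp_bind]
  rfl

variable [MonoidalCategory C]

variable (C) in
/-- The tensor product, as a functor on families indexed by `Fin 2`. -/
def tensorFunctor : (Fin 2 → C) ⥤ C where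
  obj x := x 0 ⊗ x 1
  map f := f 0 ⊗ₘ f 1
  map_id x := id_tensorHom_id (x 0) (x 1)
  map_comp f g := (tensorHom_comp_tensorHom (f 0) (f 1) (g 0) (g 1)).symm

/-- The map between the values of a term induced by maps between the values of its variables. -/
def valueMap {x y : L → C} (f : x ⟶ y) : (t : Term CommOp L) → (value x t ⟶ value y t)
  | .var l => f l
  | .op .unit _ => 𝟙 _
  | .op .mul ts => valueMap f (ts 0) ⊗ₘ valueMap f (ts 1)

/-- The functor `C^L ⥤ C` given by a term in a monoidal category. -/
def valueFunctor (t : Term CommOp L) : (L → C) ⥤ C where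
  obj x := value x t
  map f := valueMap f t
  map_id x := by
    induction t using CommOp.induction with
    | var l => rfl
    | e => rfl
    | dot s t hs ht =>
      change valueMap (𝟙 x) s ⊗ₘ valueMap (𝟙 x) t = 𝟙 (value x s ⊗ value x t)
      rw [hs, ht, id_tensorHom_id]
  map_comp {x y z} f g := by
    induction t using CommOp.induction with
    | var l => rfl
    | e => exact (Category.id_comp _).symm
    | dot s t hs ht =>
      change valueMap (f ≫ g) s ⊗ₘ valueMap (f ≫ g) t =
        (valueMap f s ⊗ₘ valueMap f t) ≫ (valueMap g s ⊗ₘ valueMap g t)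
      rw [hs, ht, tensorHom_comp_tensorHom]

lemma valueFunctor_eq_interp (t : Term CommOp L) :
    valueFunctor t = interp (tensorFunctor C) (𝟙_ C) t := by
  induction t with
  | var l => rfl
  | op a ts ih =>
    cases a with
    | unit => rfl
    | mul =>
      change _ = Functor.pi' (fun i => interp (tensorFunctor C) (𝟙_ C) (ts i)) ⋙ tensorFunctor C
      rw [← show (fun i => valueFunctor (C := C) (ts i)) = _ from funext ih]
      rfl

lemma valueFunctor_rename (t : Term CommOp L) (e : L → L') :
    valueFunctor (t.rename e) = (reindex C e).obj (valueFunctor t) := by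
  simp only [valueFunctor_eq_interp, interp_rename]

lemma valueFunctor_bind (t : Term CommOp L) (g : L → Term CommOp L') :
    valueFunctor (t.bind g) =
      Functor.pi' (fun l => valueFunctor (C := C) (g l)) ⋙ valueFunctor t := by
  simp only [valueFunctor_eq_interp, interp_bind]

lemma value_rename (x : L' → C) (t : Term CommOp L) (e : L → L') :
    value x (t.rename e) = value (fun l => x (e l)) t :=
  congrArg (fun F : (L' → C) ⥤ C => F.obj x) (valueFunctor_rename t e)

lemma value_bind (x : L' → C) (t : Term CommOp L) (g : L → Term CommOp L') :
    value x (t.bind g) = value (fun l => value x (g l)) t :=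
  congrArg (fun F : (L' → C) ⥤ C => F.obj x) (valueFunctor_bind t g)

end Interpretation

/-! ### Canonical maps and substitution -/

section CanonicalArrow

variable {C : Type u} [Category.{v} C] [MonoidalCategory C] {L L' : Type}

lemma tensor_square {X X' Y Y' Z Z' W W' : C} {f : X ⟶ Y} {g : Y ⟶ Z} {h : X ⟶ W} {k : W ⟶ Z}
    {f' : X' ⟶ Y'} {g' : Y' ⟶ Z'} {h' : X' ⟶ W'} {k' : W' ⟶ Z'} (H : f ≫ g = h ≫ k)
    (H' : f' ≫ g' = h' ≫ k') : (f ⊗ₘ f') ≫ (g ⊗ₘ g') = (h ⊗ₘ h') ≫ (k ⊗ₘ k') := by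
  simp only [tensorHom_comp_tensorHom, H, H']

lemma leftUnitor_square {X Y : C} (f : X ⟶ Y) :
    (𝟙 (𝟙_ C) ⊗ₘ f) ≫ (λ_ Y).hom = (λ_ X).hom ≫ f := by simp

lemma leftUnitor_inv_square {X Y : C} (f : X ⟶ Y) :
    f ≫ (λ_ Y).inv = (λ_ X).inv ≫ (𝟙 (𝟙_ C) ⊗ₘ f) := by simp

lemma rightUnitor_square {X Y : C} (f : X ⟶ Y) :
    (f ⊗ₘ 𝟙 (𝟙_ C)) ≫ (ρ_ Y).hom = (ρ_ X).hom ≫ f := by simp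

lemma rightUnitor_inv_square {X Y : C} (f : X ⟶ Y) :
    f ≫ (ρ_ Y).inv = (ρ_ X).inv ≫ (f ⊗ₘ 𝟙 (𝟙_ C)) := by simp

variable [SymmetricCategory C]

/-- Canonical maps are natural in the values of the variables. -/
lemma IsCanonical.naturality {x y : L → C} (f : x ⟶ y) {s t : Term CommOp L}
    {θ : value x s ⟶ value x t} (h : IsCanonical x s t θ) :
    ∃ θ', IsCanonical y s t θ' ∧ valueMap f s ≫ θ' = θ ≫ valueMap f t := by
  induction h with
  | id s => exact ⟨_, .id s, (Category.comp_id _).trans (Category.id_comp _).symm⟩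
  | comp _ _ h₁ h₂ =>
    obtain ⟨θ₁, c₁, e₁⟩ := h₁
    obtain ⟨θ₂, c₂, e₂⟩ := h₂
    exact ⟨_, c₁.comp c₂, by rw [reassoc_of% e₁, e₂, Category.assoc]⟩
  | tensor _ _ h₁ h₂ =>
    obtain ⟨θ₁, c₁, e₁⟩ := h₁
    obtain ⟨θ₂, c₂, e₂⟩ := h₂
    exact ⟨_, c₁.tensor c₂, tensor_square e₁ e₂⟩
  | associator_hom s t r =>
    exact ⟨_, .associator_hom s t r, associator_naturality (valueMap f s) (valueMap f t) _⟩
  | associator_inv s t r =>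
    exact ⟨_, .associator_inv s t r, associator_inv_naturality (valueMap f s) (valueMap f t) _⟩
  | leftUnitor_hom s => exact ⟨_, .leftUnitor_hom s, leftUnitor_square (valueMap f s)⟩
  | leftUnitor_inv s => exact ⟨_, .leftUnitor_inv s, leftUnitor_inv_square (valueMap f s)⟩
  | rightUnitor_hom s => exact ⟨_, .rightUnitor_hom s, rightUnitor_square (valueMap f s)⟩
  | rightUnitor_inv s => exact ⟨_, .rightUnitor_inv s, rightUnitor_inv_square (valueMap f s)⟩
  | braiding s t =>
    exact ⟨_, .braiding s t, BraidedCategory.braiding_naturality (valueMap f s) (valueMap f t)⟩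

/-- An arrow of `C` which is a canonical map between the values of two terms. -/
def CanonicalArrow (x : L → C) (s t : Term CommOp L) (a : Arrow C) : Prop :=
  ∃ θ, IsCanonical x s t θ ∧ a = Arrow.mk θ

lemma CanonicalArrow.comp {x : L → C} {s t r : Term CommOp L} {X Y Z : C} {f : X ⟶ Y} {g : Y ⟶ Z}
    (hf : CanonicalArrow x s t (Arrow.mk f)) (hg : CanonicalArrow x t r (Arrow.mk g)) :
    CanonicalArrow x s r (Arrow.mk (f ≫ g)) := by
  obtain ⟨θ, h, e⟩ := hf
  obtain ⟨θ', h', e'⟩ := hg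
  exact ⟨_, h.comp h', arrow_comp_congr e e'⟩

lemma CanonicalArrow.tensor {x : L → C} {s t s' t' : Term CommOp L} {X Y X' Y' : C} {f : X ⟶ Y}
    {g : X' ⟶ Y'} (hf : CanonicalArrow x s t (Arrow.mk f))
    (hg : CanonicalArrow x s' t' (Arrow.mk g)) :
    CanonicalArrow x (CommOp.dot s s') (CommOp.dot t t') (Arrow.mk (f ⊗ₘ g)) := by
  obtain ⟨θ, h, e⟩ := hf
  obtain ⟨θ', h', e'⟩ := hg
  exact ⟨_, h.tensor h', arrow_tensor_congr e e'⟩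

lemma CanonicalArrow.unique [LinearOrder L] {x : L → C} {s t : Term CommOp L} {a b : Arrow C}
    (ha : CanonicalArrow x s t a) (hb : CanonicalArrow x s t b) (hs : s.Affine) : a = b := by
  obtain ⟨θ, h, rfl⟩ := ha
  obtain ⟨θ', h', rfl⟩ := hb
  rw [h.unique h' hs]

/-- Canonical maps at the values of terms are canonical maps between substituted terms. -/
lemma IsCanonical.bind {x : L' → C} {y : L → C} {g : L → Term CommOp L'}
    (hy : ∀ l, y l = value x (g l)) {s t : Term CommOp L} {θ : value y s ⟶ value y t}
    (h : IsCanonical y s t θ) : CanonicalArrow x (s.bind g) (t.bind g) (Arrow.mk θ) := by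
  obtain rfl : y = fun l => value x (g l) := funext hy
  have hv (t : Term CommOp L) : value (fun l => value x (g l)) t = value x (t.bind g) :=
    (value_bind x t g).symm
  induction h with
  | id s => exact ⟨_, .id _, congrArg (fun X => Arrow.mk (𝟙 X)) (hv s)⟩
  | comp _ _ h₁ h₂ => exact h₁.comp h₂
  | tensor _ _ h₁ h₂ =>
    rw [bind_dot, bind_dot]
    exact h₁.tensor h₂
  | associator_hom s t r =>
    simp only [bind_dot]
    exact ⟨_, .associator_hom _ _ _, congr (congr (congrArg
      (fun X Y Z => Arrow.mk (α_ X Y Z).hom) (hv s)) (hv t)) (hv r)⟩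
  | associator_inv s t r =>
    simp only [bind_dot]
    exact ⟨_, .associator_inv _ _ _, congr (congr (congrArg
      (fun X Y Z => Arrow.mk (α_ X Y Z).inv) (hv s)) (hv t)) (hv r)⟩
  | leftUnitor_hom s =>
    rw [bind_dot, bind_e]
    exact ⟨_, .leftUnitor_hom _, congrArg (fun X => Arrow.mk (λ_ X).hom) (hv s)⟩
  | leftUnitor_inv s =>
    rw [bind_dot, bind_e]
    exact ⟨_, .leftUnitor_inv _, congrArg (fun X => Arrow.mk (λ_ X).inv) (hv s)⟩
  | rightUnitor_hom s =>
    rw [bind_dot, bind_e]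
    exact ⟨_, .rightUnitor_hom _, congrArg (fun X => Arrow.mk (ρ_ X).hom) (hv s)⟩
  | rightUnitor_inv s =>
    rw [bind_dot, bind_e]
    exact ⟨_, .rightUnitor_inv _, congrArg (fun X => Arrow.mk (ρ_ X).inv) (hv s)⟩
  | braiding s t =>
    rw [bind_dot, bind_dot]
    exact ⟨_, .braiding _ _, congr (congrArg (fun X Y => Arrow.mk (β_ X Y).hom) (hv s)) (hv t)⟩

/-- Canonical maps substituted for the variables of a term. -/
lemma CanonicalArrow.valueMap {x : L' → C} {X Y : L → C} {f : X ⟶ Y} {g g' : L → Term CommOp L'}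
    (h : ∀ l, CanonicalArrow x (g l) (g' l) (Arrow.mk (f l))) (t : Term CommOp L) :
    CanonicalArrow x (t.bind g) (t.bind g') (Arrow.mk (valueMap f t)) := by
  induction t using CommOp.induction with
  | var l => exact h l
  | e =>
    rw [bind_e, bind_e]
    exact ⟨_, .id _, rfl⟩
  | dot s t hs ht =>
    rw [bind_dot, bind_dot]
    exact hs.tensor ht

end CanonicalArrow

/-! ### The algebra structure of a symmetric monoidal category -/

section Algebra

variable {C : Type u} [Category.{v} C] [MonoidalCategory C] [SymmetricCategory C]

/-- The canonical map between the values of two linear terms. -/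
noncomputable def canonicalMap {n : ℕ} (x : Fin n → C) (p q : commCat.Op n) :
    value x (toTerm p) ⟶ value x (toTerm q) :=
  (exists_isCanonical x fun l => (p.2 l).trans (q.2 l).symm).choose

lemma isCanonical_canonicalMap {n : ℕ} (x : Fin n → C) (p q : commCat.Op n) :
    IsCanonical x (toTerm p) (toTerm q) (canonicalMap x p q) :=
  (exists_isCanonical x fun l => (p.2 l).trans (q.2 l).symm).choose_spec

lemma eq_canonicalMap {n : ℕ} {x : Fin n → C} {p q : commCat.Op n}
    {θ : value x (toTerm p) ⟶ value x (toTerm q)} (h : IsCanonical x (toTerm p) (toTerm q) θ) :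
    θ = canonicalMap x p q :=
  h.unique (isCanonical_canonicalMap x p q) (Term.Linear.affine p.2)

lemma CanonicalArrow.eq_canonicalMap {n : ℕ} {x : Fin n → C} {p q : commCat.Op n} {a : Arrow C}
    (h : CanonicalArrow x (toTerm p) (toTerm q) a) : Arrow.mk (canonicalMap x p q) = a :=
  CanonicalArrow.unique ⟨_, isCanonical_canonicalMap x p q, rfl⟩ h (Term.Linear.affine p.2)

/-- The natural transformation with canonical components between the functors given by two linear
terms. -/
noncomputable def canonicalTrans {n : ℕ} (p q : commCat.Op n) :
    valueFunctor (C := C) (toTerm p) ⟶ valueFunctor (toTerm q) where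
  app x := canonicalMap x p q
  naturality x y f := by
    obtain ⟨θ, h, e⟩ := (isCanonical_canonicalMap x p q).naturality f
    rw [Categorification.eq_canonicalMap h] at e
    exact e

lemma canonicalTrans_refl {n : ℕ} (p : commCat.Op n) : canonicalTrans (C := C) p p = 𝟙 _ := by
  ext x
  exact (eq_canonicalMap (.id _)).symm

lemma canonicalTrans_comp {n : ℕ} (p q r : commCat.Op n) :
    canonicalTrans (C := C) p q ≫ canonicalTrans q r = canonicalTrans p r := by
  ext x
  exact eq_canonicalMap ((isCanonical_canonicalMap x p q).comp (isCanonical_canonicalMap x q r))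

variable (C) in
/-- The algebra structure given by the canonical maps of a symmetric monoidal category. -/
noncomputable def canonicalAlgebra : AlgebraStructure C commCat where
  app n :=
    { obj := fun p => valueFunctor (toTerm p)
      map := fun {p q} _ => canonicalTrans p q
      map_id := fun p => canonicalTrans_refl p
      map_comp := fun {p q r} _ _ => (canonicalTrans_comp p q r).symm }
  app_map {m n} e := by
    refine Arrow.functor_ext fun p q δ => ?_
    refine arrow_natTrans_ext (valueFunctor_rename (toTerm p) e) (valueFunctor_rename (toTerm q) e)
      fun x => CanonicalArrow.eq_canonicalMap ?_
    have h := (isCanonical_canonicalMap (fun l => x (e l)) p q).bind (x := x)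
      (g := fun l => .var (e l)) (fun _ => rfl)
    rw [Term.bind_var, Term.bind_var] at h
    exact h
  app_one := rfl
  app_comp {n} k := by
    refine Arrow.functor_ext fun p q δ => ?_
    have hF (p : commCat.Op n × ∀ i, commCat.Op (k i)) :
        valueFunctor (C := C) ((toTerm p.1).compose k fun i => toTerm (p.2 i)) =
          (substitute C fun i j => finSigmaFinEquiv ⟨i, j⟩).obj
            (valueFunctor (toTerm p.1), fun i => valueFunctor (toTerm (p.2 i))) := by
      rw [Term.compose, valueFunctor_bind]
      simp only [valueFunctor_rename]
      rfl
    refine arrow_natTrans_ext (hF p) (hF q) fun x => CanonicalArrow.eq_canonicalMap ?_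
    let y (i : Fin n) (j : Fin (k i)) : C := x (finSigmaFinEquiv ⟨i, j⟩)
    -- the composite in `End(C)` first changes the inner terms, then the outer one
    have h1 := CanonicalArrow.valueMap (x := x)
      (f := fun i => canonicalMap (y i) (p.2 i) (q.2 i))
      (g := fun i => (toTerm (p.2 i)).rename fun j => finSigmaFinEquiv ⟨i, j⟩)
      (g' := fun i => (toTerm (q.2 i)).rename fun j => finSigmaFinEquiv ⟨i, j⟩)
      (fun i => by
        have h := (isCanonical_canonicalMap (y i) (p.2 i) (q.2 i)).bind (x := x)
          (g := fun j => .var (finSigmaFinEquiv ⟨i, j⟩)) (fun _ => rfl)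
        rw [Term.bind_var, Term.bind_var] at h
        exact h) (toTerm p.1)
    have h2 := (isCanonical_canonicalMap (fun i => value (y i) (toTerm (q.2 i))) p.1 q.1).bind
      (x := x) (g := fun i => (toTerm (q.2 i)).rename fun j => finSigmaFinEquiv ⟨i, j⟩)
      (fun i => (value_rename x _ _).symm)
    exact h1.comp h2

lemma builtFrom_canonicalAlgebra :
    BuiltFrom ⟨‹MonoidalCategory C›, ‹SymmetricCategory C›⟩ (canonicalAlgebra C) where
  unit _ := rfl
  mul _ := rfl
  canonical {_ p q} _ x := ⟨_, isCanonical_canonicalMap x p q, rfl⟩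

end Algebra

/-! ### Terms as renamings of linear terms -/

section Linearization

variable {L L' : Type}

lemma Term.rename_injective {Φ : ℕ → Type w} {e : L → L'} (he : Function.Injective e) :
    Function.Injective (Term.rename (Φ := Φ) e) := by
  intro s t h
  induction s generalizing t with
  | var l =>
    cases t with
    | var l' => exact congrArg _ (he (Term.var.inj h))
    | op => simp [Term.rename] at h
  | op a ts ih =>
    cases t with
    | var => simp [Term.rename] at h
    | op b us =>
      obtain ⟨rfl, h1, h2⟩ := Term.op.inj h
      obtain rfl := eq_of_heq h1
      exact congrArg _ (funext fun i => ih i (congrFun (eq_of_heq h2) i))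

/-- The map on `Fin (∑ i, k i)` with the given restrictions to the summands. -/
def join {n : ℕ} {k : Fin n → ℕ} (e : ∀ i, Fin (k i) → L) (m : Fin (∑ i, k i)) : L :=
  e (finSigmaFinEquiv.symm m).1 (finSigmaFinEquiv.symm m).2

lemma join_restrict {n : ℕ} {k : Fin n → ℕ} (e : ∀ i, Fin (k i) → L) (i : Fin n) :
    (fun j => join e (finSigmaFinEquiv ⟨i, j⟩)) = e i := by
  have (p : Σ i, Fin (k i)) : join e (finSigmaFinEquiv p) = e p.1 p.2 := by
    rw [join, Equiv.symm_apply_apply]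
  exact funext fun j => this ⟨i, j⟩

lemma Term.compose_rename {Φ : ℕ → Type w} {n : ℕ} (k : Fin n → ℕ) (f : Term Φ (Fin n))
    (g : ∀ i, Term Φ (Fin (k i))) (e : ∀ i, Fin (k i) → L) :
    (f.compose k g).rename (join e) = f.bind fun i => (g i).rename (e i) := by
  simp only [Term.compose, Term.bind_rename, Term.rename_rename]
  exact congrArg f.bind (funext fun i => congrArg (fun e => Term.rename e (g i))
    (join_restrict e i))

lemma mulQ_bind (ts : Fin 2 → Term CommOp L) : (toTerm CommOp.mulQ).bind ts = .op .mul ts :=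
  congrArg (Term.op CommOp.mul) (funext fun i => by fin_cases i <;> rfl)

variable [DecidableEq L]

lemma Term.Affine.injective {n : ℕ} {p : commCat.Op n} {e : Fin n → L}
    (h : ((toTerm p).rename e).Affine) : Function.Injective e := by
  intro i j hij
  by_contra hne
  have h1 := h (e i)
  have hp : ∀ l, (toTerm p).count l = 1 := p.2
  simp only [Term.count_rename, hp, one_mul] at h1
  have h2 := Finset.sum_le_sum_of_subset (f := fun l => if e l = e i then 1 else 0)
    (Finset.subset_univ {i, j})
  rw [Finset.sum_pair hne] at h2
  simp only [hij, if_true] at h1 h2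
  omega

lemma Term.count_rename_pos {n : ℕ} (p : commCat.Op n) (e : Fin n → L) (l : L) :
    0 < ((toTerm p).rename e).count l ↔ l ∈ Set.range e := by
  have hp : ∀ l, (toTerm p).count l = 1 := p.2
  simp [Term.count_rename, hp, Finset.card_pos, Finset.filter_nonempty_iff]

/-- Two presentations of an affine term as the renaming of a linear term differ by a bijection. -/
lemma exists_equiv_of_rename_eq {m n : ℕ} {p : commCat.Op m} {q : commCat.Op n} {e : Fin m → L}
    {e' : Fin n → L} (h : (toTerm p).rename e = (toTerm q).rename e')
    (ha : ((toTerm p).rename e).Affine) :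
    ∃ σ : Fin m ≃ Fin n, (∀ i, e' (σ i) = e i) ∧ (commCat.map σ).obj p = q := by
  have hi' : Function.Injective e' := Term.Affine.injective (h ▸ ha)
  have hr : Set.range e = Set.range e' := by
    ext l
    rw [← Term.count_rename_pos p, ← Term.count_rename_pos q, h]
  let σ := (Equiv.ofInjective e ha.injective).trans
    ((Equiv.setCongr hr).trans (Equiv.ofInjective e' hi').symm)
  have hσ (i : Fin m) : e' (σ i) = e i := Equiv.apply_ofInjective_symm hi' _
  refine ⟨σ, hσ, Subtype.ext (Term.rename_injective hi' ?_)⟩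
  refine (Term.rename_rename _ _ _).trans (Eq.trans ?_ h)
  exact congrArg (fun e => Term.rename e (toTerm p)) (funext hσ)

end Linearization

/-! ### The functors of an algebra -/

lemma commHom_eq {n : ℕ} {p q : commCat.Op n} (δ δ' : p ⟶ q) : δ = δ' :=
  (inferInstance : Quiver.IsThin (commSignature.CatOp n)) p q |>.elim δ δ'

namespace AlgebraStructure

variable {C : Type u} [Category.{v} C] (A : AlgebraStructure C commCat) {L : Type}

/-- The functor `C^n ⥤ C` which is the value of an operation of `Q`. -/
def functorOf {n : ℕ} (p : commCat.Op n) : (Fin n → C) ⥤ C := (A.app n).obj p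

/-- The value of the binary symbol. -/
abbrev mul : (Fin 2 → C) ⥤ C := A.functorOf CommOp.mulQ

/-- The value of the nullary symbol. -/
abbrev unit : C := (A.functorOf CommOp.unitQ).obj Fin.elim0

lemma unitQ_eq (e : Fin 0 → L) :
    (reindex C e).obj (A.functorOf CommOp.unitQ) = (Functor.const (L → C)).obj A.unit := by
  refine Arrow.functor_ext fun x y f => ?_
  have h (z z' : Fin 0 → C) (g : z ⟶ z') :
      Arrow.mk ((A.functorOf CommOp.unitQ).map g) = Arrow.mk (𝟙 A.unit) := by
    obtain rfl : z = Fin.elim0 := Subsingleton.elim _ _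
    obtain rfl : z' = Fin.elim0 := Subsingleton.elim _ _
    obtain rfl : g = 𝟙 _ := funext fun i => i.elim0
    exact congrArg Arrow.mk (CategoryTheory.Functor.map_id _ _)
  exact h _ _ _

lemma idQ_eq : A.functorOf CommOp.idQ = Pi.eval (fun _ : Fin 1 => C) 0 := A.app_one

lemma obj_map {m n : ℕ} (e : Fin m ≃ Fin n) (p : commCat.Op m) :
    A.functorOf ((commCat.map e).obj p) = (reindex C e).obj (A.functorOf p) :=
  congrArg (fun F : commCat.Op m ⥤ ((Fin n → C) ⥤ C) => F.obj p) (A.app_map e)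

lemma obj_comp {n : ℕ} (k : Fin n → ℕ) (p : commCat.Op n) (q : ∀ i, commCat.Op (k i)) :
    A.functorOf ((commCat.comp k).obj (p, q)) =
      (substitute C fun i j => finSigmaFinEquiv ⟨i, j⟩).obj
        (A.functorOf p, fun i => A.functorOf (q i)) :=
  congrArg (fun F : (commCat.Op n × ∀ i, commCat.Op (k i)) ⥤ ((Fin (∑ i, k i) → C) ⥤ C) =>
    F.obj (p, q)) (A.app_comp k)

/-- Every term is a renaming of a linear term on which the algebra agrees with the interpretation by
the values of the two symbols.  Renamings make the induction on terms possible, as the subterms of a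
linear term do not contain all the variables. -/
lemma exists_interp (t : Term CommOp L) : ∃ (n : ℕ) (e : Fin n → L) (p : commCat.Op n),
    (toTerm p).rename e = t ∧
      (reindex C e).obj (A.functorOf p) = interp A.mul A.unit t := by
  induction t with
  | var l => exact ⟨1, fun _ => l, CommOp.idQ, rfl, congrArg (reindex C fun _ => l).obj A.idQ_eq⟩
  | op a ts ih =>
    cases a with
    | unit =>
      exact ⟨0, Fin.elim0, CommOp.unitQ, congrArg (Term.op CommOp.unit) (Subsingleton.elim _ _),
        A.unitQ_eq _⟩
    | mul =>
      choose k e p hp hA using ih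
      refine ⟨_, join e, (commCat.comp k).obj (CommOp.mulQ, p), ?_, ?_⟩
      · refine (Term.compose_rename k (toTerm CommOp.mulQ) (fun i => toTerm (p i)) e).trans ?_
        rw [mulQ_bind, funext hp]
      · rw [obj_comp]
        have h (i : Fin 2) : (reindex C fun j => join e (finSigmaFinEquiv ⟨i, j⟩)).obj
            (A.functorOf (p i)) = interp A.mul A.unit (ts i) := by
          rw [join_restrict, hA]
        exact congrArg (fun F => Functor.pi' F ⋙ A.mul) (funext h)

/-- The functors of an algebra are determined by the values of the two symbols. -/
lemma obj_eq_interp {n : ℕ} (p : commCat.Op n) :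
    A.functorOf p = interp A.mul A.unit (toTerm p) := by
  obtain ⟨m, e, q, hq, hA⟩ := A.exists_interp (toTerm p)
  have h : (toTerm q).rename e = (toTerm p).rename id := hq.trans (Term.rename_id _).symm
  obtain ⟨σ, hσ, rfl⟩ := exists_equiv_of_rename_eq h (by rw [hq]; exact Term.Linear.affine p.2)
  obtain rfl : (fun i => σ i) = e := funext hσ
  rw [obj_map, ← hA]

/-! ### The structural arrows of an algebra -/

/-- The natural transformation given by the arrow `p ⟶ q` of `Q`. -/
def comparison {n : ℕ} (p q : commCat.Op n) : A.functorOf p ⟶ A.functorOf q :=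
  (A.app n).map (commArrow p q)

lemma comparison_refl {n : ℕ} (p : commCat.Op n) : A.comparison p p = 𝟙 _ :=
  (congrArg (A.app n).map (commHom_eq (commArrow p p) (𝟙 p))).trans ((A.app n).map_id p)

lemma comparison_comp {n : ℕ} (p q r : commCat.Op n) :
    A.comparison p q ≫ A.comparison q r = A.comparison p r :=
  ((A.app n).map_comp (commArrow p q) (commArrow q r)).symm.trans
    (congrArg (A.app n).map (commHom_eq _ _))

lemma comparison_map {m n : ℕ} (e : Fin m ≃ Fin n) (p q : commCat.Op m) (x : Fin n → C) :
    Arrow.mk ((A.comparison ((commCat.map e).obj p) ((commCat.map e).obj q)).app x) =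
      Arrow.mk ((A.comparison p q).app fun i => x (e i)) :=
  congrArg (fun F : commCat.Op m ⥤ ((Fin n → C) ⥤ C) =>
    Arrow.mk ((F.map (commArrow p q)).app x)) (A.app_map e)

lemma comparison_comp_operad {n : ℕ} (k : Fin n → ℕ) (p q : commCat.Op n)
    (p' q' : ∀ i, commCat.Op (k i)) (x : Fin (∑ i, k i) → C) :
    Arrow.mk ((A.comparison ((commCat.comp k).obj (p, p')) ((commCat.comp k).obj (q, q'))).app x) =
      Arrow.mk ((A.functorOf p).map
          (fun i => (A.comparison (p' i) (q' i)).app fun j => x (finSigmaFinEquiv ⟨i, j⟩)) ≫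
        (A.comparison p q).app fun i =>
          (A.functorOf (q' i)).obj fun j => x (finSigmaFinEquiv ⟨i, j⟩)) :=
  congrArg (fun F : (commCat.Op n × ∀ i, commCat.Op (k i)) ⥤ ((Fin (∑ i, k i) → C) ⥤ C) =>
    Arrow.mk ((F.map (X := (p, p')) (Y := (q, q'))
      (commArrow p q, fun i => commArrow (p' i) (q' i))).app x)) (A.app_comp k)

/-- An arrow of `C` is structural, for the terms `s` and `t` at the valuation `x`, if it is the
value of an arrow of `Q` between linear terms of which `s` and `t` are renamings.  The variables of
`s` and `t` need not be distinct, which makes this notion stable under substitution. -/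
def Structural (x : L → C) (s t : Term CommOp L) (a : Arrow C) : Prop :=
  ∃ (n : ℕ) (e : Fin n → L) (p q : commCat.Op n), (toTerm p).rename e = s ∧
    (toTerm q).rename e = t ∧ a = Arrow.mk ((A.comparison p q).app fun i => x (e i))

variable {A}

lemma structural_comparison {n : ℕ} (p q : commCat.Op n) (x : Fin n → C) :
    A.Structural x (toTerm p) (toTerm q) (Arrow.mk ((A.comparison p q).app x)) :=
  ⟨n, id, p, q, Term.rename_id _, Term.rename_id _, rfl⟩

lemma structural_var (x : L → C) (l : L) :
    A.Structural x (.var l) (.var l) (Arrow.mk (𝟙 (x l))) := by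
  refine ⟨1, fun _ => l, CommOp.idQ, CommOp.idQ, rfl, rfl, ?_⟩
  rw [comparison_refl, idQ_eq]
  rfl

lemma structural_e (x : L → C) :
    A.Structural x CommOp.e CommOp.e (Arrow.mk (𝟙 A.unit)) := by
  refine ⟨0, Fin.elim0, CommOp.unitQ, CommOp.unitQ, congrArg (Term.op CommOp.unit)
    (Subsingleton.elim _ _), congrArg (Term.op CommOp.unit) (Subsingleton.elim _ _), ?_⟩
  rw [comparison_refl]
  exact congrArg (fun x => Arrow.mk (𝟙 ((A.functorOf CommOp.unitQ).obj x)))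
    (Subsingleton.elim _ _)

/-- Structural arrows can be substituted into the arrows of `Q`. -/
lemma Structural.subst {x : L → C} {n : ℕ} {X Y : Fin n → C} {f : X ⟶ Y}
    {s t : Fin n → Term CommOp L} (h : ∀ i, A.Structural x (s i) (t i) (Arrow.mk (f i)))
    (p q : commCat.Op n) : A.Structural x ((toTerm p).bind s) ((toTerm q).bind t)
      (Arrow.mk ((A.functorOf p).map f ≫ (A.comparison p q).app Y)) := by
  choose k e p' q' hp hq hf using h
  refine ⟨_, join e, (commCat.comp k).obj (p, p'), (commCat.comp k).obj (q, q'), ?_, ?_, ?_⟩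
  · refine (Term.compose_rename k (toTerm p) (fun i => toTerm (p' i)) e).trans ?_
    rw [funext hp]
  · refine (Term.compose_rename k (toTerm q) (fun i => toTerm (q' i)) e).trans ?_
    rw [funext hq]
  · -- the arrows `f i` enter through `Arrow C`, as their sources and targets are only equal to the
    -- values of the operations `p' i` and `q' i`
    let Ψ (a : Fin n → Arrow C) : Arrow C :=
      Arrow.mk ((A.functorOf p).map (fun i => (a i).hom : (fun i => (a i).left) ⟶ _) ≫
        (A.comparison p q).app fun i => (a i).right)
    have hf' (i : Fin n) : Arrow.mk (f i) = Arrow.mk ((A.comparison (p' i) (q' i)).app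
        fun j => x (join e (finSigmaFinEquiv ⟨i, j⟩))) := by
      rw [hf, ← join_restrict e i]
    exact (congrArg Ψ (funext hf')).trans
      (A.comparison_comp_operad k p q p' q' fun m => x (join e m)).symm

lemma Structural.subst_id {x : L → C} {n : ℕ} {X : Fin n → C} {s : Fin n → Term CommOp L}
    (h : ∀ i, A.Structural x (s i) (s i) (Arrow.mk (𝟙 (X i)))) (p q : commCat.Op n) :
    A.Structural x ((toTerm p).bind s) ((toTerm q).bind s)
      (Arrow.mk ((A.comparison p q).app X)) := by
  have := Structural.subst (f := 𝟙 X) h p q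
  rwa [CategoryTheory.Functor.map_id, Category.id_comp] at this

lemma Structural.subst_map {x : L → C} {n : ℕ} {X Y : Fin n → C} {f : X ⟶ Y}
    {s t : Fin n → Term CommOp L} (h : ∀ i, A.Structural x (s i) (t i) (Arrow.mk (f i)))
    (p : commCat.Op n) : A.Structural x ((toTerm p).bind s) ((toTerm p).bind t)
      (Arrow.mk ((A.functorOf p).map f)) := by
  have := Structural.subst h p p
  rwa [comparison_refl, NatTrans.id_app, Category.comp_id] at this

variable [DecidableEq L]

/-- Structural arrows compose, if the variables of the middle term are distinct: its two
presentations as a renaming of a linear term then differ by a bijection. -/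
lemma Structural.comp {x : L → C} {s t r : Term CommOp L} {X Y Z : C} {f : X ⟶ Y} {g : Y ⟶ Z}
    (hf : A.Structural x s t (Arrow.mk f)) (hg : A.Structural x t r (Arrow.mk g)) (ht : t.Affine) :
    A.Structural x s r (Arrow.mk (f ≫ g)) := by
  obtain ⟨m, e, p, q, rfl, rfl, hf⟩ := hf
  obtain ⟨n, e', q', r', hq, rfl, hg⟩ := hg
  obtain ⟨σ, hσ, rfl⟩ := exists_equiv_of_rename_eq hq.symm ht
  obtain rfl : (fun i => e' (σ i)) = e := funext hσ
  obtain ⟨r, rfl⟩ : ∃ r, (commCat.map σ).obj r = r' := ⟨(commCat.map σ.symm).obj r',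
    Subtype.ext ((Term.rename_rename _ _ _).trans (by simp [Term.rename_id]))⟩
  refine ⟨m, _, p, r, rfl, (Term.rename_rename _ _ _).symm, ?_⟩
  rw [← comparison_comp A p q r, NatTrans.comp_app]
  exact arrow_comp_congr hf (hg.trans (A.comparison_map σ q r _))

/-- Between affine terms there is only one structural arrow. -/
lemma Structural.unique {x : L → C} {s t : Term CommOp L} {a b : Arrow C}
    (ha : A.Structural x s t a) (hb : A.Structural x s t b) (hs : s.Affine) : a = b := by
  obtain ⟨m, e, p, q, rfl, rfl, ha⟩ := ha
  obtain ⟨n, e', p', q', hp, hq, hb⟩ := hb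
  obtain ⟨σ, hσ, rfl⟩ := exists_equiv_of_rename_eq hp.symm hs
  obtain rfl : (fun i => e' (σ i)) = e := funext hσ
  have hi : Function.Injective e' := Term.Affine.injective (hp ▸ hs)
  obtain rfl : (commCat.map σ).obj q = q' :=
    Subtype.ext (Term.rename_injective hi ((Term.rename_rename _ _ _).trans hq.symm))
  rw [ha, hb, comparison_map]

lemma Structural.eq {x : L → C} {s t : Term CommOp L} {X Y : C} {f g : X ⟶ Y}
    (hf : A.Structural x s t (Arrow.mk f)) (hg : A.Structural x s t (Arrow.mk g)) (hs : s.Affine) :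
    f = g :=
  (Arrow.mk_inj _ _).1 (hf.unique hg hs)

end AlgebraStructure

namespace AlgebraStructure

variable {C : Type u} [Category.{v} C] (A : AlgebraStructure C commCat)

/-! ### The symmetric monoidal structure of an algebra -/

/-- The tensor product of objects. -/
def tensorObj (X Y : C) : C := A.mul.obj ![X, Y]

/-- The tensor product of arrows. -/
def tensorHom {X X' Y Y' : C} (f : X ⟶ X') (g : Y ⟶ Y') : A.tensorObj X Y ⟶ A.tensorObj X' Y' :=
  A.mul.map (X := ![X, Y]) (Y := ![X', Y']) fun i => match i with
    | 0 => f
    | 1 => g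

lemma tensorHom_id (X Y : C) : A.tensorHom (𝟙 X) (𝟙 Y) = 𝟙 (A.tensorObj X Y) := by
  refine (congrArg A.mul.map (funext fun i => ?_)).trans (A.mul.map_id _)
  fin_cases i <;> rfl

lemma tensorHom_comp {X X' X'' Y Y' Y'' : C} (f : X ⟶ X') (f' : X' ⟶ X'') (g : Y ⟶ Y')
    (g' : Y' ⟶ Y'') :
    A.tensorHom f g ≫ A.tensorHom f' g' = A.tensorHom (f ≫ f') (g ≫ g') := by
  refine (A.mul.map_comp _ _).symm.trans (congrArg A.mul.map (funext fun i => ?_))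
  fin_cases i <;> rfl

lemma tensorHom_congr {X Y Z W X' Y' Z' W' : C} {f : X ⟶ Y} {g : Z ⟶ W}
    {f' : X' ⟶ Y'} {g' : Z' ⟶ W'} (hf : Arrow.mk f = Arrow.mk f') (hg : Arrow.mk g = Arrow.mk g') :
    Arrow.mk (A.tensorHom f g) = Arrow.mk (A.tensorHom f' g') := by
  obtain rfl : X = X' := congrArg (·.left) hf
  obtain rfl : Y = Y' := congrArg (·.right) hf
  obtain rfl : Z = Z' := congrArg (·.left) hg
  obtain rfl : W = W' := congrArg (·.right) hg
  rw [Arrow.mk_inj] at hf hg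
  rw [hf, hg]

lemma mul_obj (x : Fin 2 → C) : A.mul.obj x = A.tensorObj (x 0) (x 1) :=
  congrArg A.mul.obj (funext fun i => by fin_cases i <;> rfl)

lemma mul_map {x y : Fin 2 → C} (f : x ⟶ y) :
    Arrow.mk (A.mul.map f) = Arrow.mk (A.tensorHom (f 0) (f 1)) := by
  have key (a b : Fin 2 → C) (g : a ⟶ b) (ha : a = x) (hb : b = y)
      (h : ∀ i, Arrow.mk (f i) = Arrow.mk (g i)) :
      Arrow.mk (A.mul.map f) = Arrow.mk (A.mul.map g) := by
    subst ha hb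
    rw [show f = g from funext fun i => (Arrow.mk_inj _ _).1 (h i)]
  refine key _ _ _ (funext fun i => ?_) (funext fun i => ?_) fun i => ?_ <;> fin_cases i <;> rfl

lemma interp_dot_map {L : Type} (s t : Term CommOp L) {x y : L → C} (f : x ⟶ y) :
    Arrow.mk ((interp A.mul A.unit (CommOp.dot s t)).map f) =
      Arrow.mk (A.tensorHom ((interp A.mul A.unit s).map f) ((interp A.mul A.unit t).map f)) :=
  A.mul_map _

lemma functorOf_map {n : ℕ} (p : commCat.Op n) {x y : Fin n → C} (f : x ⟶ y) :
    Arrow.mk ((A.functorOf p).map f) = Arrow.mk ((interp A.mul A.unit (toTerm p)).map f) := by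
  rw [obj_eq_interp]

lemma assocLeftQ_map {x y : Fin 3 → C} (f : x ⟶ y) :
    Arrow.mk ((A.functorOf CommOp.assocLeftQ).map f) =
      Arrow.mk (A.tensorHom (A.tensorHom (f 0) (f 1)) (f 2)) :=
  (A.functorOf_map _ f).trans <| (A.interp_dot_map _ _ f).trans <|
    A.tensorHom_congr (A.interp_dot_map _ _ f) rfl

lemma assocRightQ_map {x y : Fin 3 → C} (f : x ⟶ y) :
    Arrow.mk ((A.functorOf CommOp.assocRightQ).map f) =
      Arrow.mk (A.tensorHom (f 0) (A.tensorHom (f 1) (f 2))) :=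
  (A.functorOf_map _ f).trans <| (A.interp_dot_map _ _ f).trans <|
    A.tensorHom_congr rfl (A.interp_dot_map _ _ f)

lemma unitMulQ_map {x y : Fin 1 → C} (f : x ⟶ y) :
    Arrow.mk ((A.functorOf CommOp.unitMulQ).map f) = Arrow.mk (A.tensorHom (𝟙 A.unit) (f 0)) :=
  (A.functorOf_map _ f).trans (A.interp_dot_map _ _ f)

lemma mulUnitQ_map {x y : Fin 1 → C} (f : x ⟶ y) :
    Arrow.mk ((A.functorOf CommOp.mulUnitQ).map f) = Arrow.mk (A.tensorHom (f 0) (𝟙 A.unit)) :=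
  (A.functorOf_map _ f).trans (A.interp_dot_map _ _ f)

lemma idQ_map {x y : Fin 1 → C} (f : x ⟶ y) :
    Arrow.mk ((A.functorOf CommOp.idQ).map f) = Arrow.mk (f 0) :=
  A.functorOf_map _ f

lemma swapQ_map {x y : Fin 2 → C} (f : x ⟶ y) :
    Arrow.mk ((A.functorOf CommOp.swapQ).map f) = Arrow.mk (A.tensorHom (f 1) (f 0)) :=
  (A.functorOf_map _ f).trans (A.interp_dot_map _ _ f)

/-- The natural isomorphism given by the arrow `p ⟶ q` of `Q`. -/
def comparisonIso {n : ℕ} (p q : commCat.Op n) : A.functorOf p ≅ A.functorOf q where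
  hom := A.comparison p q
  inv := A.comparison q p
  hom_inv_id := by rw [comparison_comp, comparison_refl]
  inv_hom_id := by rw [comparison_comp, comparison_refl]

/-- The value of `F` on objects, extracted from its value on an identity arrow. -/
lemma obj_eq_of_map {n : ℕ} {F : (Fin n → C) ⥤ C} {x : Fin n → C} {X : C} {f : X ⟶ X}
    (h : Arrow.mk (F.map (𝟙 x)) = Arrow.mk f) : X = F.obj x :=
  (congrArg (·.left) h).symm

/-- The associator `(X ⊗ Y) ⊗ Z ≅ X ⊗ (Y ⊗ Z)`, with Mathlib's orientation: it is the inverse of the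
value of `x₀ . (x₁ . x₂) ⟶ (x₀ . x₁) . x₂`. -/
def associator (X Y Z : C) :
    A.tensorObj (A.tensorObj X Y) Z ≅ A.tensorObj X (A.tensorObj Y Z) :=
  castIso ((A.comparisonIso CommOp.assocLeftQ CommOp.assocRightQ).app ![X, Y, Z])
    (obj_eq_of_map (A.assocLeftQ_map (𝟙 ![X, Y, Z])))
    (obj_eq_of_map (A.assocRightQ_map (𝟙 ![X, Y, Z])))

/-- The left unitor `I ⊗ X ≅ X`. -/
def leftUnitor (X : C) : A.tensorObj A.unit X ≅ X :=
  castIso ((A.comparisonIso CommOp.unitMulQ CommOp.idQ).app ![X])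
    (obj_eq_of_map (A.unitMulQ_map (𝟙 ![X])))
    (obj_eq_of_map (A.idQ_map (𝟙 ![X])))

/-- The right unitor `X ⊗ I ≅ X`. -/
def rightUnitor (X : C) : A.tensorObj X A.unit ≅ X :=
  castIso ((A.comparisonIso CommOp.mulUnitQ CommOp.idQ).app ![X])
    (obj_eq_of_map (A.mulUnitQ_map (𝟙 ![X])))
    (obj_eq_of_map (A.idQ_map (𝟙 ![X])))

/-- The braiding `X ⊗ Y ≅ Y ⊗ X`.  It is evaluated at `(Y, X)`, as the arrow of `Q` goes from
`x₁ . x₀` to `x₀ . x₁`. -/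
def braiding (X Y : C) : A.tensorObj X Y ≅ A.tensorObj Y X :=
  castIso ((A.comparisonIso CommOp.swapQ CommOp.mulQ).app ![Y, X])
    (obj_eq_of_map (A.swapQ_map (𝟙 ![Y, X]))) rfl

lemma associator_eq (x : Fin 3 → C) : Arrow.mk (A.associator (x 0) (x 1) (x 2)).hom =
    Arrow.mk ((A.comparison CommOp.assocLeftQ CommOp.assocRightQ).app x) := by
  refine (castIso_hom _ _ _).trans (congrArg (fun y => Arrow.mk
    ((A.comparison CommOp.assocLeftQ CommOp.assocRightQ).app y)) (funext fun i => ?_))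
  fin_cases i <;> rfl

lemma associator_inv_eq (x : Fin 3 → C) : Arrow.mk (A.associator (x 0) (x 1) (x 2)).inv =
    Arrow.mk ((A.comparison CommOp.assocRightQ CommOp.assocLeftQ).app x) := by
  refine (castIso_inv _ _ _).trans (congrArg (fun y => Arrow.mk
    ((A.comparison CommOp.assocRightQ CommOp.assocLeftQ).app y)) (funext fun i => ?_))
  fin_cases i <;> rfl

lemma leftUnitor_eq (x : Fin 1 → C) : Arrow.mk (A.leftUnitor (x 0)).hom =
    Arrow.mk ((A.comparison CommOp.unitMulQ CommOp.idQ).app x) := by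
  refine (castIso_hom _ _ _).trans (congrArg (fun y => Arrow.mk
    ((A.comparison CommOp.unitMulQ CommOp.idQ).app y)) (funext fun i => ?_))
  fin_cases i; rfl

lemma leftUnitor_inv_eq (x : Fin 1 → C) : Arrow.mk (A.leftUnitor (x 0)).inv =
    Arrow.mk ((A.comparison CommOp.idQ CommOp.unitMulQ).app x) := by
  refine (castIso_inv _ _ _).trans (congrArg (fun y => Arrow.mk
    ((A.comparison CommOp.idQ CommOp.unitMulQ).app y)) (funext fun i => ?_))
  fin_cases i; rfl

lemma rightUnitor_eq (x : Fin 1 → C) : Arrow.mk (A.rightUnitor (x 0)).hom =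
    Arrow.mk ((A.comparison CommOp.mulUnitQ CommOp.idQ).app x) := by
  refine (castIso_hom _ _ _).trans (congrArg (fun y => Arrow.mk
    ((A.comparison CommOp.mulUnitQ CommOp.idQ).app y)) (funext fun i => ?_))
  fin_cases i; rfl

lemma rightUnitor_inv_eq (x : Fin 1 → C) : Arrow.mk (A.rightUnitor (x 0)).inv =
    Arrow.mk ((A.comparison CommOp.idQ CommOp.mulUnitQ).app x) := by
  refine (castIso_inv _ _ _).trans (congrArg (fun y => Arrow.mk
    ((A.comparison CommOp.idQ CommOp.mulUnitQ).app y)) (funext fun i => ?_))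
  fin_cases i; rfl

lemma braiding_eq (x : Fin 2 → C) : Arrow.mk (A.braiding (x 1) (x 0)).hom =
    Arrow.mk ((A.comparison CommOp.swapQ CommOp.mulQ).app x) := by
  refine (castIso_hom _ _ _).trans (congrArg (fun y => Arrow.mk
    ((A.comparison CommOp.swapQ CommOp.mulQ).app y)) (funext fun i => ?_))
  fin_cases i <;> rfl

lemma associator_naturality {X Y Z X' Y' Z' : C} (f : X ⟶ X') (g : Y ⟶ Y') (h : Z ⟶ Z') :
    A.tensorHom (A.tensorHom f g) h ≫ (A.associator X' Y' Z').hom =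
      (A.associator X Y Z).hom ≫ A.tensorHom f (A.tensorHom g h) := by
  let k : ![X, Y, Z] ⟶ ![X', Y', Z'] := fun i => match i with
    | 0 => f
    | 1 => g
    | 2 => h
  exact arrow_square_congr
    ((A.comparison CommOp.assocLeftQ CommOp.assocRightQ).naturality k)
    (A.assocLeftQ_map k).symm (A.associator_eq ![X', Y', Z']) (A.associator_eq ![X, Y, Z])
    (A.assocRightQ_map k).symm

lemma leftUnitor_naturality {X X' : C} (f : X ⟶ X') :
    A.tensorHom (𝟙 A.unit) f ≫ (A.leftUnitor X').hom = (A.leftUnitor X).hom ≫ f := by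
  let k : ![X] ⟶ ![X'] := fun i => match i with | 0 => f
  exact arrow_square_congr ((A.comparison CommOp.unitMulQ CommOp.idQ).naturality k)
    (A.unitMulQ_map k).symm (A.leftUnitor_eq ![X']) (A.leftUnitor_eq ![X]) (A.idQ_map k).symm

lemma rightUnitor_naturality {X X' : C} (f : X ⟶ X') :
    A.tensorHom f (𝟙 A.unit) ≫ (A.rightUnitor X').hom = (A.rightUnitor X).hom ≫ f := by
  let k : ![X] ⟶ ![X'] := fun i => match i with | 0 => f
  exact arrow_square_congr ((A.comparison CommOp.mulUnitQ CommOp.idQ).naturality k)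
    (A.mulUnitQ_map k).symm (A.rightUnitor_eq ![X']) (A.rightUnitor_eq ![X]) (A.idQ_map k).symm

lemma braiding_naturality {X X' Y Y' : C} (f : X ⟶ X') (g : Y ⟶ Y') :
    A.tensorHom f g ≫ (A.braiding X' Y').hom = (A.braiding X Y).hom ≫ A.tensorHom g f := by
  let k : ![Y, X] ⟶ ![Y', X'] := fun i => match i with
    | 0 => g
    | 1 => f
  exact arrow_square_congr ((A.comparison CommOp.swapQ CommOp.mulQ).naturality k)
    (A.swapQ_map k).symm (A.braiding_eq ![Y', X']) (A.braiding_eq ![Y, X]) (A.mul_map k).symm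

/-! ### The coherence conditions -/

section Structural

variable {A} {L : Type} {x : L → C} {s s' t t' r : Term CommOp L} {X X' Y Y' Z : C}

lemma Structural.tensor {f : X ⟶ X'} {g : Y ⟶ Y'} (hf : A.Structural x s s' (Arrow.mk f))
    (hg : A.Structural x t t' (Arrow.mk g)) :
    A.Structural x (CommOp.dot s t) (CommOp.dot s' t') (Arrow.mk (A.tensorHom f g)) := by
  have := Structural.subst_map (s := ![s, t]) (t := ![s', t']) (X := ![X, Y]) (Y := ![X', Y'])
    (f := fun i => match i with
      | 0 => f
      | 1 => g) (fun i => by fin_cases i; exacts [hf, hg]) CommOp.mulQ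
  rw [mulQ_bind, mulQ_bind] at this
  exact this

lemma structural_associator (hs : A.Structural x s s (Arrow.mk (𝟙 X)))
    (ht : A.Structural x t t (Arrow.mk (𝟙 Y))) (hr : A.Structural x r r (Arrow.mk (𝟙 Z))) :
    A.Structural x (CommOp.dot (CommOp.dot s t) r) (CommOp.dot s (CommOp.dot t r))
      (Arrow.mk (A.associator X Y Z).hom) := by
  have := Structural.subst_id (s := ![s, t, r]) (X := ![X, Y, Z])
    (fun i => by fin_cases i; exacts [hs, ht, hr]) CommOp.assocLeftQ CommOp.assocRightQ
  rw [← associator_eq] at this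
  simp only [toTerm, CommOp.assocLeftQ, CommOp.assocRightQ, ofTerm, bind_dot] at this
  exact this

lemma structural_associator_inv (hs : A.Structural x s s (Arrow.mk (𝟙 X)))
    (ht : A.Structural x t t (Arrow.mk (𝟙 Y))) (hr : A.Structural x r r (Arrow.mk (𝟙 Z))) :
    A.Structural x (CommOp.dot s (CommOp.dot t r)) (CommOp.dot (CommOp.dot s t) r)
      (Arrow.mk (A.associator X Y Z).inv) := by
  have := Structural.subst_id (s := ![s, t, r]) (X := ![X, Y, Z])
    (fun i => by fin_cases i; exacts [hs, ht, hr]) CommOp.assocRightQ CommOp.assocLeftQ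
  rw [← associator_inv_eq] at this
  simp only [toTerm, CommOp.assocLeftQ, CommOp.assocRightQ, ofTerm, bind_dot] at this
  exact this

lemma structural_leftUnitor (hs : A.Structural x s s (Arrow.mk (𝟙 X))) :
    A.Structural x (CommOp.dot CommOp.e s) s (Arrow.mk (A.leftUnitor X).hom) := by
  have := Structural.subst_id (s := ![s]) (X := ![X])
    (fun i => by fin_cases i; exact hs) CommOp.unitMulQ CommOp.idQ
  rw [← leftUnitor_eq] at this
  simp only [toTerm, CommOp.unitMulQ, ofTerm, bind_dot, bind_e] at this
  exact this

lemma structural_leftUnitor_inv (hs : A.Structural x s s (Arrow.mk (𝟙 X))) :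
    A.Structural x s (CommOp.dot CommOp.e s) (Arrow.mk (A.leftUnitor X).inv) := by
  have := Structural.subst_id (s := ![s]) (X := ![X])
    (fun i => by fin_cases i; exact hs) CommOp.idQ CommOp.unitMulQ
  rw [← leftUnitor_inv_eq] at this
  simp only [toTerm, CommOp.unitMulQ, ofTerm, bind_dot, bind_e] at this
  exact this

lemma structural_rightUnitor (hs : A.Structural x s s (Arrow.mk (𝟙 X))) :
    A.Structural x (CommOp.dot s CommOp.e) s (Arrow.mk (A.rightUnitor X).hom) := by
  have := Structural.subst_id (s := ![s]) (X := ![X])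
    (fun i => by fin_cases i; exact hs) CommOp.mulUnitQ CommOp.idQ
  rw [← rightUnitor_eq] at this
  simp only [toTerm, CommOp.mulUnitQ, ofTerm, bind_dot, bind_e] at this
  exact this

lemma structural_rightUnitor_inv (hs : A.Structural x s s (Arrow.mk (𝟙 X))) :
    A.Structural x s (CommOp.dot s CommOp.e) (Arrow.mk (A.rightUnitor X).inv) := by
  have := Structural.subst_id (s := ![s]) (X := ![X])
    (fun i => by fin_cases i; exact hs) CommOp.idQ CommOp.mulUnitQ
  rw [← rightUnitor_inv_eq] at this
  simp only [toTerm, CommOp.mulUnitQ, ofTerm, bind_dot, bind_e] at this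
  exact this

lemma structural_braiding (hs : A.Structural x s s (Arrow.mk (𝟙 X)))
    (ht : A.Structural x t t (Arrow.mk (𝟙 Y))) :
    A.Structural x (CommOp.dot s t) (CommOp.dot t s) (Arrow.mk (A.braiding X Y).hom) := by
  have := Structural.subst_id (s := ![t, s]) (X := ![Y, X])
    (fun i => by fin_cases i; exacts [ht, hs]) CommOp.swapQ CommOp.mulQ
  rw [← braiding_eq] at this
  simp only [toTerm, CommOp.swapQ, CommOp.mulQ, ofTerm, bind_dot] at this
  exact this

lemma structural_tensor_id (hs : A.Structural x s s (Arrow.mk (𝟙 X)))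
    (ht : A.Structural x t t (Arrow.mk (𝟙 Y))) :
    A.Structural x (CommOp.dot s t) (CommOp.dot s t) (Arrow.mk (𝟙 (A.tensorObj X Y))) := by
  rw [← tensorHom_id]
  exact hs.tensor ht

end Structural

instance {L : Type} [DecidableEq L] [Fintype L] (t : Term CommOp L) : Decidable t.Affine :=
  inferInstanceAs (Decidable (∀ l, t.count l ≤ 1))

lemma pentagon (W X Y Z : C) :
    A.tensorHom (A.associator W X Y).hom (𝟙 Z) ≫ (A.associator W (A.tensorObj X Y) Z).hom ≫
        A.tensorHom (𝟙 W) (A.associator X Y Z).hom =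
      (A.associator (A.tensorObj W X) Y Z).hom ≫ (A.associator W X (A.tensorObj Y Z)).hom := by
  have w : A.Structural ![W, X, Y, Z] (.var 0) (.var 0) (Arrow.mk (𝟙 W)) := structural_var _ _
  have x : A.Structural ![W, X, Y, Z] (.var 1) (.var 1) (Arrow.mk (𝟙 X)) := structural_var _ _
  have y : A.Structural ![W, X, Y, Z] (.var 2) (.var 2) (Arrow.mk (𝟙 Y)) := structural_var _ _
  have z : A.Structural ![W, X, Y, Z] (.var 3) (.var 3) (Arrow.mk (𝟙 Z)) := structural_var _ _
  refine Structural.eq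
    (((structural_associator w x y).tensor z).comp
      ((structural_associator w (structural_tensor_id x y) z).comp
        (w.tensor (structural_associator x y z)) ?_) ?_)
    ((structural_associator (structural_tensor_id w x) y z).comp
      (structural_associator w x (structural_tensor_id y z)) ?_) ?_ <;> decide

lemma triangle (X Y : C) :
    (A.associator X A.unit Y).hom ≫ A.tensorHom (𝟙 X) (A.leftUnitor Y).hom =
      A.tensorHom (A.rightUnitor X).hom (𝟙 Y) := by
  have x : A.Structural ![X, Y] (.var 0) (.var 0) (Arrow.mk (𝟙 X)) := structural_var _ _
  have y : A.Structural ![X, Y] (.var 1) (.var 1) (Arrow.mk (𝟙 Y)) := structural_var _ _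
  refine Structural.eq
    ((structural_associator x (structural_e _) y).comp (x.tensor (structural_leftUnitor y)) ?_)
    ((structural_rightUnitor x).tensor y) ?_ <;> decide

lemma symmetry (X Y : C) : (A.braiding X Y).hom ≫ (A.braiding Y X).hom = 𝟙 (A.tensorObj X Y) := by
  have x : A.Structural ![X, Y] (.var 0) (.var 0) (Arrow.mk (𝟙 X)) := structural_var _ _
  have y : A.Structural ![X, Y] (.var 1) (.var 1) (Arrow.mk (𝟙 Y)) := structural_var _ _
  refine Structural.eq ((structural_braiding x y).comp (structural_braiding y x) ?_)
    (structural_tensor_id x y) ?_ <;> decide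

lemma hexagon_forward (X Y Z : C) :
    (A.associator X Y Z).hom ≫ (A.braiding X (A.tensorObj Y Z)).hom ≫ (A.associator Y Z X).hom =
      A.tensorHom (A.braiding X Y).hom (𝟙 Z) ≫ (A.associator Y X Z).hom ≫
        A.tensorHom (𝟙 Y) (A.braiding X Z).hom := by
  have x : A.Structural ![X, Y, Z] (.var 0) (.var 0) (Arrow.mk (𝟙 X)) := structural_var _ _
  have y : A.Structural ![X, Y, Z] (.var 1) (.var 1) (Arrow.mk (𝟙 Y)) := structural_var _ _
  have z : A.Structural ![X, Y, Z] (.var 2) (.var 2) (Arrow.mk (𝟙 Z)) := structural_var _ _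
  refine Structural.eq
    ((structural_associator x y z).comp
      ((structural_braiding x (structural_tensor_id y z)).comp (structural_associator y z x) ?_) ?_)
    (((structural_braiding x y).tensor z).comp
      ((structural_associator y x z).comp (y.tensor (structural_braiding x z)) ?_) ?_) ?_ <;> decide

lemma hexagon_reverse (X Y Z : C) :
    (A.associator X Y Z).inv ≫ (A.braiding (A.tensorObj X Y) Z).hom ≫ (A.associator Z X Y).inv =
      A.tensorHom (𝟙 X) (A.braiding Y Z).hom ≫ (A.associator X Z Y).inv ≫
        A.tensorHom (A.braiding X Z).hom (𝟙 Y) := by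
  have x : A.Structural ![X, Y, Z] (.var 0) (.var 0) (Arrow.mk (𝟙 X)) := structural_var _ _
  have y : A.Structural ![X, Y, Z] (.var 1) (.var 1) (Arrow.mk (𝟙 Y)) := structural_var _ _
  have z : A.Structural ![X, Y, Z] (.var 2) (.var 2) (Arrow.mk (𝟙 Z)) := structural_var _ _
  refine Structural.eq
    ((structural_associator_inv x y z).comp
      ((structural_braiding (structural_tensor_id x y) z).comp
        (structural_associator_inv z x y) ?_) ?_)
    ((x.tensor (structural_braiding y z)).comp
      ((structural_associator_inv x z y).comp ((structural_braiding x z).tensor y) ?_) ?_) ?_ <;>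
    decide

/-- The monoidal category given by an algebra. -/
@[reducible] def monoidalCategory : MonoidalCategory C where
  tensorObj := A.tensorObj
  whiskerLeft X _ _ f := A.tensorHom (𝟙 X) f
  whiskerRight f Y := A.tensorHom f (𝟙 Y)
  tensorHom f g := A.tensorHom f g
  tensorUnit := A.unit
  associator := A.associator
  leftUnitor := A.leftUnitor
  rightUnitor := A.rightUnitor
  tensorHom_def f g := by rw [tensorHom_comp, Category.comp_id, Category.id_comp]
  id_tensorHom_id := A.tensorHom_id
  tensorHom_comp_tensorHom f₁ f₂ g₁ g₂ := A.tensorHom_comp f₁ g₁ f₂ g₂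
  whiskerLeft_id := A.tensorHom_id
  id_whiskerRight := A.tensorHom_id
  associator_naturality := A.associator_naturality
  leftUnitor_naturality := A.leftUnitor_naturality
  rightUnitor_naturality := A.rightUnitor_naturality
  pentagon := A.pentagon
  triangle := A.triangle

/-- The symmetry of the monoidal category given by an algebra. -/
@[reducible] def symmetricCategory :
    letI := A.monoidalCategory
    SymmetricCategory C :=
  letI := A.monoidalCategory
  { braiding := A.braiding
    braiding_naturality_right := fun X _ _ f => A.braiding_naturality (𝟙 X) f
    braiding_naturality_left := fun f Z => A.braiding_naturality f (𝟙 Z)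
    hexagon_forward := A.hexagon_forward
    hexagon_reverse := A.hexagon_reverse
    symmetry := A.symmetry }

/-- The symmetric monoidal structure read off from an algebra structure. -/
def symMonStructure : SymMonStructure C where
  monoidal := A.monoidalCategory
  symmetric := A.symmetricCategory

lemma readOff : ReadOff A A.symMonStructure where
  tensorObj x := (A.mul_obj x).symm
  tensorHom f := (A.mul_map f).symm
  unit _ := congrArg (A.functorOf CommOp.unitQ).obj (Subsingleton.elim _ _)
  associator x := A.associator_inv_eq x
  leftUnitor x := A.leftUnitor_eq x
  rightUnitor x := A.rightUnitor_eq x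
  braiding x := A.braiding_eq x

/-- The functors of the algebra built from the monoidal category of `A` are those of `A`. -/
lemma functorOf_canonicalAlgebra {n : ℕ} (p : commCat.Op n) :
    letI := A.monoidalCategory
    valueFunctor (toTerm p) = A.functorOf p := by
  let := A.monoidalCategory
  rw [valueFunctor_eq_interp, obj_eq_interp]
  have h : tensorFunctor C = A.mul := Arrow.functor_ext fun x y f => (A.mul_map f).symm
  rw [h]
  rfl

lemma structural_id {L : Type} (x : L → C) (s : Term CommOp L) :
    letI := A.monoidalCategory
    A.Structural x s s (Arrow.mk (𝟙 (value x s))) := by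
  let := A.monoidalCategory
  induction s using CommOp.induction with
  | var l => exact structural_var x l
  | e => exact structural_e x
  | dot s t hs ht => exact structural_tensor_id hs ht

/-- Canonical maps are structural arrows. -/
lemma structural_of_isCanonical {L : Type} [DecidableEq L] {x : L → C} {s t : Term CommOp L} :
    letI := A.monoidalCategory
    letI := A.symmetricCategory
    ∀ {θ : value x s ⟶ value x t}, IsCanonical x s t θ → s.Affine →
      A.Structural x s t (Arrow.mk θ) := by
  let := A.monoidalCategory
  let := A.symmetricCategory
  intro θ h hs
  have hid := A.structural_id x
  induction h with
  | id s => exact hid s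
  | comp h₁ _ ih₁ ih₂ => exact (ih₁ hs).comp (ih₂ (h₁.affine hs)) (h₁.affine hs)
  | tensor _ _ ih₁ ih₂ => exact (ih₁ hs.left).tensor (ih₂ hs.right)
  | associator_hom s t r => exact structural_associator (hid s) (hid t) (hid r)
  | associator_inv s t r => exact structural_associator_inv (hid s) (hid t) (hid r)
  | leftUnitor_hom s => exact structural_leftUnitor (hid s)
  | leftUnitor_inv s => exact structural_leftUnitor_inv (hid s)
  | rightUnitor_hom s => exact structural_rightUnitor (hid s)
  | rightUnitor_inv s => exact structural_rightUnitor_inv (hid s)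
  | braiding s t => exact structural_braiding (hid s) (hid t)

end AlgebraStructure

/-! ### The two constructions are mutually inverse -/

/-- The algebra structure built from a symmetric monoidal structure. -/
noncomputable def SymMonStructure.algebra {C : Type u} [Category.{v} C] (M : SymMonStructure C) :
    AlgebraStructure C commCat :=
  letI := M.monoidal
  letI := M.symmetric
  canonicalAlgebra C

lemma SymMonStructure.builtFrom {C : Type u} [Category.{v} C] (M : SymMonStructure C) :
    BuiltFrom M M.algebra :=
  letI := M.monoidal
  letI := M.symmetric
  builtFrom_canonicalAlgebra

/-- An algebra structure is recovered from the symmetric monoidal structure read off from it. -/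
theorem AlgebraStructure.algebra_symMonStructure {C : Type u} [Category.{v} C]
    (A : AlgebraStructure C commCat) : A.symMonStructure.algebra = A := by
  let := A.monoidalCategory
  let := A.symmetricCategory
  refine SymCatOperad.Hom.ext (funext fun n => Arrow.functor_ext fun p q δ => ?_)
  refine arrow_natTrans_ext (A.functorOf_canonicalAlgebra p) (A.functorOf_canonicalAlgebra q)
    fun x => ?_
  have h1 := A.structural_of_isCanonical (isCanonical_canonicalMap x p q) (Term.Linear.affine p.2)
  rw [commHom_eq δ (commArrow p q)]
  exact h1.unique (structural_comparison p q x) (Term.Linear.affine p.2)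

section Uniqueness

variable {C : Type u} [Category.{v} C]

lemma monoidalCategoryStruct_ext {S S' : MonoidalCategoryStruct C}
    (hO : ∀ X Y, S.tensorObj X Y = S'.tensorObj X Y) (hI : S.tensorUnit = S'.tensorUnit)
    (hL : ∀ (X : C) {Y Z : C} (f : Y ⟶ Z),
      Arrow.mk (S.whiskerLeft X f) = Arrow.mk (S'.whiskerLeft X f))
    (hR : ∀ {X Y : C} (f : X ⟶ Y) (Z : C),
      Arrow.mk (S.whiskerRight f Z) = Arrow.mk (S'.whiskerRight f Z))
    (hT : ∀ {X Y X' Y' : C} (f : X ⟶ Y) (g : X' ⟶ Y'),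
      Arrow.mk (S.tensorHom f g) = Arrow.mk (S'.tensorHom f g))
    (hα : ∀ X Y Z, Arrow.mk (S.associator X Y Z).inv = Arrow.mk (S'.associator X Y Z).inv)
    (hl : ∀ X, Arrow.mk (S.leftUnitor X).hom = Arrow.mk (S'.leftUnitor X).hom)
    (hr : ∀ X, Arrow.mk (S.rightUnitor X).hom = Arrow.mk (S'.rightUnitor X).hom) : S = S' := by
  obtain ⟨O, wL, wR, T, I, α, l, r⟩ := S
  obtain ⟨O', wL', wR', T', I', α', l', r'⟩ := S'
  obtain rfl : O = O' := funext fun X => funext (hO X)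
  obtain rfl : I = I' := hI
  congr 1
  · funext X Y Z f
    exact (Arrow.mk_inj _ _).1 (hL X f)
  · funext X Y f Z
    exact (Arrow.mk_inj _ _).1 (hR f Z)
  · funext X Y X' Y' f g
    exact (Arrow.mk_inj _ _).1 (hT f g)
  · funext X Y Z
    exact Iso.ext_inv ((Arrow.mk_inj _ _).1 (hα X Y Z))
  · funext X
    exact Iso.ext ((Arrow.mk_inj _ _).1 (hl X))
  · funext X
    exact Iso.ext ((Arrow.mk_inj _ _).1 (hr X))

lemma monoidalCategory_ext {M M' : MonoidalCategory C}
    (h : M.toMonoidalCategoryStruct = M'.toMonoidalCategoryStruct) : M = M' := by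
  cases M
  cases M'
  congr

lemma symmetricCategory_ext [MonoidalCategory C] {S S' : SymmetricCategory C}
    (h : ∀ X Y : C, (S.braiding X Y).hom = (S'.braiding X Y).hom) : S = S' := by
  obtain @⟨⟨β, _, _, _, _⟩, _⟩ := S
  obtain @⟨⟨β', _, _, _, _⟩, _⟩ := S'
  obtain rfl : β = β' := funext fun X => funext fun Y => Iso.ext (h X Y)
  rfl

variable {A : AlgebraStructure C commCat}

lemma ReadOff.tensorHom_eq {M : SymMonStructure C} (h : ReadOff A M) {X Y X' Y' : C} (f : X ⟶ Y)
    (g : X' ⟶ Y') : Arrow.mk (M.monoidal.tensorHom f g) = Arrow.mk (A.tensorHom f g) :=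
  h.tensorHom (x := ![X, X']) (y := ![Y, Y']) fun i => match i with
    | 0 => f
    | 1 => g

/-- The symmetric monoidal structure read off from an algebra structure is unique. -/
theorem ReadOff.unique {M M' : SymMonStructure C} (h : ReadOff A M) (h' : ReadOff A M') :
    M = M' := by
  have hT {X Y X' Y' : C} (f : X ⟶ Y) (g : X' ⟶ Y') :
      Arrow.mk (M.monoidal.tensorHom f g) = Arrow.mk (M'.monoidal.tensorHom f g) :=
    (h.tensorHom_eq f g).trans (h'.tensorHom_eq f g).symm
  have hM : M.monoidal = M'.monoidal := monoidalCategory_ext <| monoidalCategoryStruct_ext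
    (fun X Y => (h.tensorObj ![X, Y]).trans (h'.tensorObj ![X, Y]).symm)
    ((h.unit Fin.elim0).trans (h'.unit Fin.elim0).symm)
    (fun X {Y Z} f => by
      have := hT (𝟙 X) f
      rwa [@id_tensorHom _ _ M.monoidal, @id_tensorHom _ _ M'.monoidal] at this)
    (fun {X Y} f Z => by
      have := hT f (𝟙 Z)
      rwa [@tensorHom_id _ _ M.monoidal, @tensorHom_id _ _ M'.monoidal] at this)
    hT
    (fun X Y Z => (h.associator ![X, Y, Z]).trans (h'.associator ![X, Y, Z]).symm)
    (fun X => (h.leftUnitor ![X]).trans (h'.leftUnitor ![X]).symm)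
    (fun X => (h.rightUnitor ![X]).trans (h'.rightUnitor ![X]).symm)
  obtain ⟨M, S⟩ := M
  obtain ⟨M', S'⟩ := M'
  obtain rfl : M = M' := hM
  have hS : S = S' := symmetricCategory_ext fun X Y => (Arrow.mk_inj _ _).1
    ((h.braiding ![Y, X]).trans (h'.braiding ![Y, X]).symm)
  rw [hS]

end Uniqueness

lemma SymMonStructure.readOff {C : Type u} [Category.{v} C] (M : SymMonStructure C) :
    ReadOff M.algebra M :=
  letI := M.monoidal
  letI := M.symmetric
  { tensorObj := fun _ => rfl
    tensorHom := fun _ => rfl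
    unit := fun _ => rfl
    associator := fun _ => congrArg Arrow.mk (eq_canonicalMap (p := CommOp.assocRightQ)
      (q := CommOp.assocLeftQ) (.associator_inv (.var 0) (.var 1) (.var 2)))
    leftUnitor := fun _ => congrArg Arrow.mk (eq_canonicalMap (p := CommOp.unitMulQ)
      (q := CommOp.idQ) (.leftUnitor_hom (.var 0)))
    rightUnitor := fun _ => congrArg Arrow.mk (eq_canonicalMap (p := CommOp.mulUnitQ)
      (q := CommOp.idQ) (.rightUnitor_hom (.var 0)))
    braiding := fun _ => congrArg Arrow.mk (eq_canonicalMap (p := CommOp.swapQ)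
      (q := CommOp.mulQ) (.braiding (.var 1) (.var 0))) }

end Categorification

theorem mainTheorem3 (C : Type u) [Category.{v} C] :
    ∃ (R : Categorification.AlgebraStructure C Categorification.commCat →
        Categorification.SymMonStructure C)
      (S : Categorification.SymMonStructure C →
        Categorification.AlgebraStructure C Categorification.commCat),
      Function.LeftInverse S R ∧ Function.RightInverse S R ∧
        (∀ A, Categorification.ReadOff A (R A)) ∧ ∀ M, Categorification.BuiltFrom M (S M) :=
  ⟨fun A => A.symMonStructure, fun M => M.algebra, fun A => A.algebra_symMonStructure,
    fun M => M.algebra.readOff.unique M.readOff, fun A => A.readOff, fun M => M.builtFrom⟩
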